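/- Let $x=(x_1,x_2,x_3,\dots)$ be infinitely many independent real (or complex) variables. Define the elementary Schur polynomials $p_0,p_1,p_2,\dots$ by $$\sum_{n\ge 0}p_n(x)\kappa^n=\exp\sum_{i\ge 1}x_i\kappa^i ,$$ put $\tilde\partial=(\partial_{x_1},\tfrac12\partial_{x_2},\tfrac13\partial_{x_3},\dots)$ and $\tilde D=(D_{x_1},\tfrac12D_{x_2},\tfrac13D_{x_3},\dots)$, where the $D_{x_i}$ are Hirota's operators: for a polynomial $P$, $P(D_{x_1},D_{x_2},\dots)f\cdot g\,(x)=P(\partial_{y_1},\partial_{y_2},\dots)\,f(x+y)g(x-y)\big|_{y=0}$. Let $U$ be a set of points $x$ such that every slice of $U$, obtained by letting finitely many of the coordinates vary and fixing the others, is open (call such sets open), and let $\tau_n$ $(n\in\mathbb Z)$ be real- or complex-valued functions on $U$ that are smooth (holomorphic, if the variables are complex) in any finitely many of the variables jointly. Suppose that on $U$ they satisfy the bilinear equations of the one-dimensional Toda lattice hierarchy and of the first modified KP hierarchy, that is, for all $n\in\mathbb Z$ and $j=0,1,2,\dots$, $$D_{x_1}p_{j+1}\bigl(\tfrac12\tilde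 D\bigr)\,\tau_n\cdot\tau_n=p_j\bigl(\tfrac12\tilde D\bigr)\,\tau_{n+1}\cdot\tau_{n-1},$$ $$\Bigl[D_{x_1}p_j\bigl(\tfrac12\tilde D\bigr)-p_{j+1}\bigl(\tfrac12\tilde D\bigr)+p_{j+1}\bigl(-\tfrac12\tilde D\bigr)\Bigr]\tau_{n+1}\cdot\tau_n=0 .$$ Suppose also that no $\tau_m$ vanishes between two that do not: if $\tau_m$ vanishes identically on an open set $W\subseteq U$, then so does $\tau_l\tau_n$ for all $l<m<n$ (this holds in particular if no $\tau_m$ vanishes identically on a nonempty open subset of $U$). Then for every $k\in\mathbb Z$ and every $n\in\mathbb Z$, at every point of $U$ at which $\tau_k\ne0$, $$\frac{\tau_{k+n}}{\tau_k}=\begin{cases}\det\bigl(a^{(k)}_{i+j-2}\bigr)_{i,j=1,\dots,n}& n>0,\\ 1& n=0,\\ \det\bigl(b^{(k)}_{i+j-2}\bigr)_{i,j=1,\dots,|n|}& n<0,\end{cases}$$ where $$a^{(k)}_i=p_i(\tilde\partial)\,\frac{\tau_{k+1}}{\tau_k},\qquad b^{(k)}_i=(-1)^ip_i(-\tilde\partial)\,\frac{\tau_{k-1}}{\tau_k}.$$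 -/

import Mathlib

open scoped ContDiff

noncomputable section

namespace TodaKP

/-- The elementary Schur polynomial `p_n` in the variables `x_1, x_2, …`: the coefficient of `κ ^ n`
in `exp (∑_{i ≥ 1} x_i κ ^ i)`, computed in the formal power series over `ℚ[x_1, x_2, …]`. -/
def schur (n : ℕ) : MvPolynomial ℕ+ ℚ :=
  PowerSeries.coeff n ((PowerSeries.exp ℚ).subst
    (PowerSeries.mk fun i : ℕ =>
      if h : 0 < i then (MvPolynomial.X (⟨i, h⟩ : ℕ+) : MvPolynomial ℕ+ ℚ) else 0))

/-- `p_n (c X_1, (c / 2) X_2, (c / 3) X_3, …)`. Putting `X_i = ∂_{x_i}` with `c = 1` or `c = -1`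
gives `p_n (∂̃)` or `p_n (-∂̃)`; putting `X_i = D_{x_i}` with `c = 1 / 2` or `c = -1 / 2` gives
`p_n (D̃ / 2)` or `p_n (-D̃ / 2)`. -/
def schurTilde (c : ℚ) (n : ℕ) : MvPolynomial ℕ+ ℚ :=
  MvPolynomial.bind₁ (fun i : ℕ+ => MvPolynomial.C (c / (i : ℚ)) * MvPolynomial.X i) (schur n)

section Functions

variable {𝕜 𝕂 : Type*} [RCLike 𝕜] [RCLike 𝕂] [NormedAlgebra 𝕜 𝕂]

/-- A set of points `x = (x_1, x_2, …)` is open in finitely many variables at a time: its trace on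
every slice obtained by letting finitely many of the coordinates vary is open. -/
def FinOpen (U : Set (ℕ+ → 𝕜)) : Prop :=
  ∀ (x : ℕ+ → 𝕜) (s : Finset ℕ+), IsOpen {y : s → 𝕜 | Function.updateFinset x s y ∈ U}

/-- A function of `x = (x_1, x_2, …)` is smooth on `U`: it is smooth in any finitely many of the
variables jointly, the other variables being fixed. -/
def SmoothOn (U : Set (ℕ+ → 𝕜)) (f : (ℕ+ → 𝕜) → 𝕂) : Prop :=
  ∀ (x : ℕ+ → 𝕜) (s : Finset ℕ+),
    ContDiffOn 𝕜 ∞ (fun y : s → 𝕜 => f (Function.updateFinset x s y))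
      {y : s → 𝕜 | Function.updateFinset x s y ∈ U}

/-- The partial derivative `∂f / ∂x_i`. -/
def partialD (i : ℕ+) (f : (ℕ+ → 𝕜) → 𝕂) : (ℕ+ → 𝕜) → 𝕂 :=
  fun x => deriv (fun t : 𝕜 => f (Function.update x i t)) (x i)

/-- The iterated partial derivative `∂^m f` for a multi-index `m`. (The partial derivatives are
taken in a fixed order, which is immaterial for smooth functions.) -/
def iterPartialD (m : ℕ+ →₀ ℕ) (f : (ℕ+ → 𝕜) → 𝕂) : (ℕ+ → 𝕜) → 𝕂 :=
  ((Finsupp.toMultiset m).sort (· ≤ ·)).foldr partialD f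

/-- `P (∂_{x_1}, ∂_{x_2}, …) f` for a polynomial `P`. -/
def diffOp (P : MvPolynomial ℕ+ ℚ) (f : (ℕ+ → 𝕜) → 𝕂) : (ℕ+ → 𝕜) → 𝕂 :=
  fun x => ∑ m ∈ P.support, ((P.coeff m : ℚ) : 𝕂) * iterPartialD m f x

/-- Hirota's bilinear operator
`P (D_{x_1}, D_{x_2}, …) f · g = P (∂_{y_1}, ∂_{y_2}, …) (f (x + y) g (x - y))` at `y = 0`. -/
def hirota (P : MvPolynomial ℕ+ ℚ) (f g : (ℕ+ → 𝕜) → 𝕂) : (ℕ+ → 𝕜) → 𝕂 :=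
  fun x => diffOp P (fun y => f (x + y) * g (x - y)) 0

/-- `(τ_n)_{n ∈ ℤ}` are smooth functions on `U` that satisfy the bilinear equations of the
one-dimensional Toda lattice hierarchy and of the first modified KP hierarchy. -/
structure IsTau (U : Set (ℕ+ → 𝕜)) (τ : ℤ → (ℕ+ → 𝕜) → 𝕂) : Prop where
  smooth : ∀ n : ℤ, SmoothOn U (τ n)
  toda : ∀ (n : ℤ) (j : ℕ), ∀ x ∈ U,
    hirota (MvPolynomial.X 1 * schurTilde (1 / 2) (j + 1)) (τ n) (τ n) x =
      hirota (schurTilde (1 / 2) j) (τ (n + 1)) (τ (n - 1)) x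
  modifiedKP : ∀ (n : ℤ) (j : ℕ), ∀ x ∈ U,
    hirota (MvPolynomial.X 1 * schurTilde (1 / 2) j - schurTilde (1 / 2) (j + 1)
      + schurTilde (-1 / 2) (j + 1)) (τ (n + 1)) (τ n) x = 0

/-- No `τ_m` vanishes between two that do not: where `τ_m` vanishes identically on an open set, so
does `τ_l τ_n` for all `l < m < n`. (This holds in particular if no `τ_m` vanishes identically on a
nonempty open subset of `U`.) -/
def NoGaps (U : Set (ℕ+ → 𝕜)) (τ : ℤ → (ℕ+ → 𝕜) → 𝕂) : Prop :=
  ∀ W ⊆ U, FinOpen W → ∀ l m n : ℤ, l < m → m < n →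
    (∀ x ∈ W, τ m x = 0) → ∀ x ∈ W, τ l x * τ n x = 0

/-- The entries `a_i^{(k)} = p_i (∂̃) (τ_{k+1} / τ_k)`. -/
def entryA (τ : ℤ → (ℕ+ → 𝕜) → 𝕂) (k : ℤ) (i : ℕ) : (ℕ+ → 𝕜) → 𝕂 :=
  diffOp (schurTilde 1 i) (fun x => τ (k + 1) x / τ k x)

/-- The entries `b_i^{(k)} = (-1)^i p_i (-∂̃) (τ_{k-1} / τ_k)`. -/
def entryB (τ : ℤ → (ℕ+ → 𝕜) → 𝕂) (k : ℤ) (i : ℕ) : (ℕ+ → 𝕜) → 𝕂 :=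
  fun x => (-1) ^ i * diffOp (schurTilde (-1) i) (fun x => τ (k - 1) x / τ k x) x

end Functions

end TodaKP

end

/-! Write `[κ] = (κ, κ²/2, κ³/3, …)`. The operators `p_i(∂̃)` are the Taylor coefficients of the
shift `x ↦ x + [κ]`, so the `a_i^{(k)}` are the coefficients of `F_k = τ_{k+1}(x + [κ]) / τ_k(x +
[κ])`, and the determinants are Hankel determinants of this series.

In generating form the two hierarchies relate values at `x + [κ]/2` and `x - [κ]/2`. A further
formal shift by `[κ]/2` makes them relate `T_j = τ_j(x + [κ])` and `t_j = τ_j(x)`. Eliminating `∂_1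
T_{j+1}` leaves a three-term relation between `T_j`, `T_{j+1}`, `T_{j+2}`, which says `F_j (1 - s κ
- κ² (t_j / t_{j+1}) F_{j+1}) = t_{j+1} / t_j` for some `s` free of `κ`. This is one step of a
Jacobi continued fraction, so `hankelDet_succ_of_mul_eq` turns it into `H_{n+1}(F_j) = (t_{j+1} /
t_j) H_n(F_{j+1})`, and the product telescopes (`hankelDet_eq_of_toda_of_modifiedKP`). Negative `n`
is the same argument for `x - [κ]`, with `κ` replaced by `-κ` and the indices reversed.

All this takes place in a commutative `ℚ`-algebra with commuting derivations, where `flow` is the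
formal shift; `IsTau.isFormalTau` translates Hirota's equations into it. The telescoping divides by
the intermediate `τ`, which may vanish. `mul_eq_of_forall_finOpen` shrinks to open sets where they
are invertible, or where one vanishes identically; there the fraction terminates, and the absence of
gaps makes the later `τ` vanish as well. -/

noncomputable section

namespace TodaKP

/-! ### Hankel determinants and Jacobi continued fractions -/

section Hankel

open PowerSeries Finset

variable {A : Type*} [CommRing A]

/-- The Hankel determinant `det (f_{i + j})` of size `n` of a power series `f`. -/
def hankelDet (f : A⟦X⟧) (n : ℕ) : A :=
  (Matrix.of fun i j : Fin n => coeff ((i : ℕ) + (j : ℕ)) f).det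

theorem hankelDet_one (f : A⟦X⟧) : hankelDet f 1 = constantCoeff f := by
  simp [hankelDet]

theorem hankelDet_zero_left (n : ℕ) : hankelDet (0 : A⟦X⟧) (n + 1) = 0 := by
  unfold hankelDet
  exact Matrix.det_eq_zero_of_row_eq_zero 0 (by simp)

theorem hankelDet_C_mul (r : A) (f : A⟦X⟧) (n : ℕ) :
    hankelDet (C r * f) n = r ^ n * hankelDet f n := by
  have : (Matrix.of fun i j : Fin n => coeff ((i : ℕ) + (j : ℕ)) (C r * f)) =
      r • (Matrix.of fun i j : Fin n => coeff ((i : ℕ) + (j : ℕ)) f) := by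
    ext i j; simp
  rw [hankelDet, this, Matrix.det_smul, Fintype.card_fin, hankelDet]

/-- One step of a Jacobi continued fraction: `f = c / (1 - s X - X² g)`. -/
theorem hankelDet_succ_of_mul_eq {f g : A⟦X⟧} {s c : A}
    (h : f * (1 - C s * X - X ^ 2 * g) = C c) (n : ℕ) :
    hankelDet f (n + 1) = c ^ (n + 1) * hankelDet g n := by
  set q : A⟦X⟧ := 1 - C s * X - X ^ 2 * g with hq
  have hq0 : coeff 0 q = 1 := by simp [hq]
  have hq2 (k : ℕ) : coeff (k + 2) q = - coeff k g := by
    have h1 : coeff (k + 2) (1 : A⟦X⟧) = 0 := by simp [coeff_one]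
    have h2 : coeff (k + 2) (C s * X) = 0 := by simp
    have h3 : coeff (k + 2) (X ^ 2 * g) = coeff k g := coeff_X_pow_mul g 2 k
    rw [hq, map_sub, map_sub, h1, h2, h3]; ring
  have hf0 : coeff 0 f = c := by
    have := congrArg (coeff 0) h
    simpa [coeff_mul, hq0] using this
  -- Coefficient `i + j` of `q * f = C c`, split according to whether the index of `q` is at most
  -- `i`.
  have hconv (i j : ℕ) : ∑ l ∈ range (i + 1), coeff (i - l) q * coeff (l + j) f +
      ∑ l ∈ range j, coeff (i + 1 + l) q * coeff (j - 1 - l) f =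
        if i + j = 0 then c else 0 := by
    have h1 := congrArg (coeff (i + j)) h
    rw [mul_comm, coeff_mul, coeff_C, Finset.Nat.sum_antidiagonal_eq_sum_range_succ_mk] at h1
    dsimp only at h1
    rw [← h1, Nat.succ_eq_add_one, add_right_comm,
      Finset.sum_range_add (fun k => coeff k q * coeff (i + j - k) f)]
    congr 1
    · rw [← Finset.sum_range_reflect (fun k => coeff k q * coeff (i + j - k) f)]
      refine Finset.sum_congr rfl fun l hl => ?_
      have := Finset.mem_range.1 hl
      congr 3; omega
    · refine Finset.sum_congr rfl fun l hl => ?_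
      have := Finset.mem_range.1 hl
      congr 3; omega
  -- Multiplying the Hankel matrix `M` by the unitriangular Toeplitz matrix `L` of `q` clears its
  -- first column below the corner `c`. The remaining block is `G * R`, since the coefficients of
  -- `q` from degree 2 on are those of `-g`; `R` is triangular with diagonal `c`.
  let L : Matrix (Fin (n + 1)) (Fin (n + 1)) A :=
    Matrix.of fun i l => if (l : ℕ) ≤ (i : ℕ) then coeff ((i : ℕ) - (l : ℕ)) q else 0
  let M : Matrix (Fin (n + 1)) (Fin (n + 1)) A :=
    Matrix.of fun i j => coeff ((i : ℕ) + (j : ℕ)) f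
  let G : Matrix (Fin n) (Fin n) A := Matrix.of fun i j => coeff ((i : ℕ) + (j : ℕ)) g
  let R : Matrix (Fin n) (Fin n) A :=
    Matrix.of fun l j => if (l : ℕ) ≤ (j : ℕ) then coeff ((j : ℕ) - (l : ℕ)) f else 0
  have hL : L.det = 1 := by
    rw [Matrix.det_of_isLowerTriangular L]
    · simp [L, hq0]
    · intro i j hij
      have : i < j := hij
      simp [L, this]
  have hR : R.det = c ^ n := by
    rw [Matrix.det_of_isUpperTriangular]
    · simp only [R, Matrix.of_apply, le_refl, if_true, Nat.sub_self, hf0]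
      simp
    · intro i j hij
      have : j < i := hij
      simp [R, this]
  have hLM (i j : Fin (n + 1)) : (L * M) i j =
      (if (i : ℕ) + (j : ℕ) = 0 then c else 0) -
        ∑ l ∈ range (j : ℕ), coeff ((i : ℕ) + 1 + l) q * coeff ((j : ℕ) - 1 - l) f := by
    rw [← hconv, add_sub_cancel_right, Matrix.mul_apply]
    simp only [L, M, Matrix.of_apply, ite_mul, zero_mul]
    rw [Fin.sum_univ_eq_sum_range (fun l => if l ≤ (i : ℕ) then
      coeff ((i : ℕ) - l) q * coeff (l + (j : ℕ)) f else 0) (n + 1), ← Finset.sum_filter]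
    refine Finset.sum_congr ?_ fun _ _ => rfl
    ext l
    simp only [Finset.mem_filter, Finset.mem_range]
    omega
  have hsub : (L * M).submatrix Fin.succ Fin.succ = G * R := by
    ext i j
    rw [Matrix.submatrix_apply, hLM, Matrix.mul_apply]
    simp only [G, R, Matrix.of_apply, mul_ite, mul_zero]
    rw [if_neg (by simp), zero_sub, Fin.val_succ, Fin.val_succ, ← Finset.sum_neg_distrib,
      Fin.sum_univ_eq_sum_range (fun l => if l ≤ (j : ℕ) then
        coeff ((i : ℕ) + l) g * coeff ((j : ℕ) - l) f else 0) n, ← Finset.sum_filter]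
    have hr : {l ∈ range n | l ≤ (j : ℕ)} = range ((j : ℕ) + 1) := by
      ext l
      simp only [Finset.mem_filter, Finset.mem_range]
      omega
    rw [hr]
    refine Finset.sum_congr rfl fun l _ => ?_
    rw [show (i : ℕ) + 1 + 1 + l = (i : ℕ) + l + 2 by ring, hq2]
    simp
  have hdet : (L * M).det = c * (G * R).det := by
    rw [Matrix.det_succ_column_zero, Fin.sum_univ_succ]
    rw [Finset.sum_eq_zero, add_zero]
    · rw [← hsub, hLM, Fin.succAbove_zero]
      simp
    · intro i _
      rw [hLM]
      simp
  rw [Matrix.det_mul, Matrix.det_mul, hL, hR, one_mul] at hdet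
  change M.det = _ * G.det
  rw [hdet]; ring

/-- A formal shift `T_j = τ_j(x + [κ])` of `t_j = τ_j(x)`, together with the derivatives `T'`, `t'`
with respect to `x_1`, which satisfies the Toda and the modified KP equations: the Hankel
determinants of `T_1 / T_0` are the quotients `t_n / t_0`. -/
theorem hankelDet_eq_of_toda_of_modifiedKP {t t' : ℕ → A} {T T' F : ℕ → A⟦X⟧}
    (hT : ∀ j, constantCoeff (T j) = t j)
    (toda : ∀ j, T' (j + 1) * C (t (j + 1)) - T (j + 1) * C (t' (j + 1)) =
      X * (T (j + 2) * C (t j)))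
    (mkp : ∀ j, X * (T' (j + 1) * C (t j) - T (j + 1) * C (t' j)) =
      T (j + 1) * C (t j) - C (t (j + 1)) * T j)
    (hF : ∀ j, IsUnit (t j) → F j * T j = T (j + 1)) (m : ℕ) :
    ∀ n j : ℕ, (∀ i ≤ m, IsUnit (t (j + i))) → m ≤ n →
      (n = m ∨ T (j + m + 1) = 0 ∧ t (j + n + 1) = 0) →
        hankelDet (F j) (n + 1) * t j = t (j + n + 1) := by
  have unitT (j : ℕ) (h : IsUnit (t j)) : IsUnit (T j) := by
    rw [isUnit_iff_constantCoeff, hT]; exact h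
  have hF0 (j : ℕ) (h : IsUnit (t j)) : constantCoeff (F j) * t j = t (j + 1) := by
    rw [← hT (j + 1), ← hF j h, map_mul, hT]
  induction m with
  | zero =>
    intro n j hu _ h
    have h0 := hu 0 le_rfl
    rcases h with rfl | ⟨h1, h2⟩
    · rw [hankelDet_one]; exact hF0 j h0
    -- The continued fraction terminates here.
    · have : F j = 0 := (unitT _ h0).mul_left_eq_zero.1 ((hF j h0).trans h1)
      rw [this, hankelDet_zero_left, h2, zero_mul]
  | succ m ih =>
    intro n j hu hn h
    obtain ⟨n, rfl⟩ := Nat.exists_eq_add_of_le' (le_trans (Nat.le_add_left 1 m) hn)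
    have ih' := ih n (j + 1) (fun i hi => by
      have := hu (i + 1) (by omega)
      rwa [show j + 1 + i = j + (i + 1) by ring]) (by omega) (by
      rw [show j + 1 + m + 1 = j + (m + 1) + 1 by ring,
        show j + 1 + n + 1 = j + (n + 1) + 1 by ring]
      rcases h with h | h
      · left; omega
      · exact Or.inr h)
    obtain ⟨a, ha⟩ := (hu 0 (by omega)).exists_right_inv
    obtain ⟨b, hb⟩ := (hu 1 (by omega)).exists_right_inv
    rw [add_zero] at ha
    have hT1 := unitT _ (hu 1 (by omega))
    have ha' : C (t j) * C a = 1 := by rw [← map_mul, ha, map_one]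
    have hb' : C (t (j + 1)) * C b = 1 := by rw [← map_mul, hb, map_one]
    -- Here `a` and `b` invert `t j` and `t (j + 1)`. The relation is `b X` times Toda minus `a`
    -- times modified KP, in which `T' (j + 1)` cancels, divided by `T j`.
    have key : F j * (1 - C (b * t' (j + 1) - a * t' j) * X - X ^ 2 * (C (t j * b) * F (j + 1))) =
        C (t (j + 1) * a) := by
      refine (unitT j (hu 0 (by omega))).mul_right_cancel ?_
      have e0 := hF j (hu 0 (by omega))
      have e1 := hF (j + 1) (hu 1 (by omega))
      simp only [map_mul, map_sub]
      linear_combination (1 - (C b * C (t' (j + 1)) - C a * C (t' j)) * X -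
        X ^ 2 * (C (t j) * C b * F (j + 1))) * e0 - X ^ 2 * C (t j) * C b * e1 +
        X * C b * toda j - C a * mkp j + (X * T' (j + 1) - T (j + 1)) * ha' -
        X * T' (j + 1) * hb'
    rw [hankelDet_succ_of_mul_eq key, hankelDet_C_mul]
    rw [show j + (n + 1) + 1 = j + 1 + n + 1 by ring, ← ih']
    -- The step contributes `(t (j + 1) / t j) ^ (n + 2)` and the factor in front of `F (j + 1)` its
    -- inverse to the power `n + 1`; one quotient survives.
    have e : (t (j + 1) * a) ^ (n + 1) * (t j * b) ^ (n + 1) = 1 := by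
      rw [← mul_pow, show t (j + 1) * a * (t j * b) = t j * a * (t (j + 1) * b) by ring, ha, hb,
        one_mul, one_pow]
    linear_combination t (j + 1) * a * t j * hankelDet (F (j + 1)) (n + 1) * e +
      t (j + 1) * hankelDet (F (j + 1)) (n + 1) * ha

/-- `hankelDet_eq_of_toda_of_modifiedKP` for a formal shift that is a ring homomorphism `Φ`. -/
theorem hankelDet_mul_eq_of_ringHom {Φ : A →+* A⟦X⟧} (hΦ : ∀ a, constantCoeff (Φ a) = a)
    {D : A → A} {t : ℕ → A}
    (toda : ∀ j, Φ (D (t (j + 1))) * C (t (j + 1)) - Φ (t (j + 1)) * C (D (t (j + 1))) =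
      X * (Φ (t (j + 2)) * C (t j)))
    (mkp : ∀ j, X * (Φ (D (t (j + 1))) * C (t j) - Φ (t (j + 1)) * C (D (t j))) =
      Φ (t (j + 1)) * C (t j) - C (t (j + 1)) * Φ (t j))
    {q : A} (hq : q * t 0 = t 1) {m n : ℕ} (hu : ∀ i ≤ m, IsUnit (t i)) (hmn : m ≤ n)
    (h : n = m ∨ t (m + 1) = 0 ∧ t (n + 1) = 0) :
    hankelDet (Φ q) (n + 1) * t 0 = t (n + 1) := by
  -- `Ring.inverse` gives a quotient for every `j`; its value at a non-unit is never used.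
  have hF (j : ℕ) (hj : IsUnit (t j)) :
      (Φ (t (j + 1) * Ring.inverse (t j))) * Φ (t j) = Φ (t (j + 1)) := by
    rw [← map_mul, mul_assoc, Ring.inverse_mul_cancel _ hj, mul_one]
  have key := hankelDet_eq_of_toda_of_modifiedKP (t := t) (t' := fun j => D (t j))
    (T := fun j => Φ (t j)) (T' := fun j => Φ (D (t j)))
    (F := fun j => Φ (t (j + 1) * Ring.inverse (t j))) (fun j => hΦ _) toda mkp hF m n 0
    (by simpa using hu) hmn (by
      rcases h with h | ⟨h1, h2⟩
      · exact Or.inl h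
      · exact Or.inr ⟨by simp [h1], by simpa using h2⟩)
  have hq' : t (0 + 1) * Ring.inverse (t 0) = q := by
    rw [zero_add, ← hq, mul_assoc, Ring.mul_inverse_cancel _ (hu 0 (Nat.zero_le _)), mul_one]
  simpa only [hq', zero_add] using key

end Hankel

/-! ### Recurrence for the elementary Schur polynomials -/

section SchurRecurrence

open PowerSeries Finset

/-- The variable `X_n`, with the convention `X_0 = 0`. -/
def varOrZero (n : ℕ) : MvPolynomial ℕ+ ℚ :=
  if h : 0 < n then MvPolynomial.X (n.toPNat h) else 0

@[simp]
theorem varOrZero_zero : varOrZero 0 = 0 := by simp [varOrZero]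

theorem derivative_exp_subst {B : Type*} [CommRing B] [Algebra ℚ B] {g : B⟦X⟧}
    (hg : HasSubst g) :
    d⁄dX B ((exp ℚ).subst g) = (exp ℚ).subst g * d⁄dX B g := by
  have h : (exp ℚ).subst g = (exp B).subst g := by
    rw [← map_exp (algebraMap ℚ B), map_algebraMap_eq_subst_X,
      subst_comp_subst_apply HasSubst.X' hg, subst_X hg]
  rw [h, derivative_subst hg, derivative_exp]

theorem schur_zero : schur 0 = 1 := by
  rw [schur]
  set g : (MvPolynomial ℕ+ ℚ)⟦X⟧ := PowerSeries.mk fun i : ℕ =>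
      if h : 0 < i then (MvPolynomial.X (⟨i, h⟩ : ℕ+) : MvPolynomial ℕ+ ℚ) else 0 with hg
  have h0 : constantCoeff g = 0 := by
    rw [← coeff_zero_eq_constantCoeff_apply, hg, coeff_mk]; simp
  rw [coeff_subst' (HasSubst.of_constantCoeff_zero' h0), finsum_eq_single _ 0]
  · simp
  · intro n hn
    simp [h0, hn]

theorem succ_smul_schur_succ (n : ℕ) :
    ((n : ℚ) + 1) • schur (n + 1) =
      ∑ p ∈ antidiagonal n, ((p.1 : ℚ) + 1) • (varOrZero (p.1 + 1) * schur p.2) := by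
  set g : (MvPolynomial ℕ+ ℚ)⟦X⟧ := PowerSeries.mk varOrZero with hg
  have h0 : constantCoeff g = 0 := by
    rw [← coeff_zero_eq_constantCoeff_apply, hg, coeff_mk]; simp
  have h := congrArg (coeff n) (derivative_exp_subst (HasSubst.of_constantCoeff_zero' h0))
  rw [coeff_derivative, mul_comm ((exp ℚ).subst g), coeff_mul] at h
  have hs (m : ℕ) : coeff m ((exp ℚ).subst g) = schur m := rfl
  rw [hs, mul_comm] at h
  rw [Algebra.smul_def]
  convert h using 1
  · simp
  · refine Finset.sum_congr rfl fun p _ => ?_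
    rw [coeff_derivative, hg, coeff_mk, hs, Algebra.smul_def]
    simp; ring

theorem schurTilde_zero (c : ℚ) : schurTilde c 0 = 1 := by
  simp [schurTilde, schur_zero]

/-- `n p_n(c X̃) = c ∑_{i + j = n} X_i p_j(c X̃)`, as for the coefficients of an exponential. -/
theorem smul_schurTilde (c : ℚ) (n : ℕ) :
    (n : ℚ) • schurTilde c n =
      c • ∑ p ∈ antidiagonal n, varOrZero p.1 * schurTilde c p.2 := by
  cases n with
  | zero => simp
  | succ n =>
    have h := congrArg (MvPolynomial.bind₁
      (fun i : ℕ+ => MvPolynomial.C (c / (i : ℚ)) * MvPolynomial.X i)) (succ_smul_schur_succ n)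
    rw [map_smul, map_sum] at h
    rw [Finset.Nat.antidiagonal_succ, Finset.sum_cons]
    simp only [varOrZero_zero, zero_mul, zero_add, Finset.sum_map, Nat.cast_add, Nat.cast_one]
    refine h.trans ?_
    rw [Finset.smul_sum]
    refine Finset.sum_congr rfl fun p _ => ?_
    -- The weight `i` produced by differentiating `X_i κ^i` cancels the denominator in `c X_i / i`.
    have e : ((p.1 : ℚ) + 1) * (c / ((p.1 : ℚ) + 1)) = c := by
      field_simp
    have hv : MvPolynomial.bind₁ (fun i : ℕ+ => MvPolynomial.C (c / (i : ℚ)) * MvPolynomial.X i)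
        (varOrZero (p.1 + 1)) = MvPolynomial.C (c / ((p.1 : ℚ) + 1)) * varOrZero (p.1 + 1) := by
      rw [varOrZero, dif_pos (Nat.succ_pos _), MvPolynomial.bind₁_X_right,
        show (((p.1 + 1).toPNat (Nat.succ_pos _) : ℕ+) : ℕ) = p.1 + 1 from rfl,
        Nat.cast_add, Nat.cast_one]
    rw [map_smul, map_mul, hv]
    change _ = c • (varOrZero (p.1 + 1) * schurTilde c p.2)
    rw [← MvPolynomial.C_mul', ← MvPolynomial.C_mul', ← mul_assoc, ← mul_assoc, ← map_mul, e,
      mul_assoc]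
    rfl

end SchurRecurrence

/-! ### Reindexing of triple convolutions -/

section Antidiagonal

open Finset

theorem sum_antidiagonal_assoc {M : Type*} [AddCommMonoid M] (g : ℕ → ℕ → ℕ → M) (n : ℕ) :
    ∑ p ∈ antidiagonal n, ∑ q ∈ antidiagonal p.1, g q.1 q.2 p.2 =
      ∑ p ∈ antidiagonal n, ∑ q ∈ antidiagonal p.2, g p.1 q.1 q.2 := by
  rw [Finset.sum_sigma', Finset.sum_sigma']
  refine Finset.sum_bij' (fun x _ => ⟨(x.2.1, x.2.2 + x.1.2), (x.2.2, x.1.2)⟩)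
    (fun x _ => ⟨(x.1.1 + x.2.1, x.2.2), (x.1.1, x.2.1)⟩) ?_ ?_ ?_ ?_ ?_ <;>
  rintro ⟨⟨a, b⟩, ⟨c, d⟩⟩ h <;>
  simp only [Finset.mem_sigma, HasAntidiagonal.mem_antidiagonal] at h ⊢ <;>
  obtain ⟨h1, h2⟩ := h <;> subst h1 <;> subst h2
  · exact ⟨(add_assoc _ _ _).symm, trivial⟩
  · exact ⟨add_assoc _ _ _, trivial⟩
  · rfl
  · rfl

theorem sum_antidiagonal_left_comm {M : Type*} [AddCommMonoid M] (g : ℕ → ℕ → ℕ → M) (n : ℕ) :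
    ∑ p ∈ antidiagonal n, ∑ q ∈ antidiagonal p.2, g p.1 q.1 q.2 =
      ∑ p ∈ antidiagonal n, ∑ q ∈ antidiagonal p.2, g q.1 p.1 q.2 := by
  rw [← sum_antidiagonal_assoc, ← sum_antidiagonal_assoc (fun a b c => g b a c)]
  refine Finset.sum_congr rfl fun p _ => ?_
  exact (Finset.Nat.sum_antidiagonal_swap (f := fun q : ℕ × ℕ => g q.1 q.2 p.2)).symm

end Antidiagonal

/-! ### Formal shifts in an algebra with commuting derivations -/

section Differential

open PowerSeries Finset

variable {A : Type*} [CommRing A] [Algebra ℚ A] (d : ℕ+ → Derivation ℚ A A)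

open scoped IsMulCommutative in
/-- `P (∂_1, ∂_2, …)` for commuting derivations `∂_i`. -/
def diffPoly (hd : ∀ i j a, d i (d j a) = d j (d i a)) :
    MvPolynomial ℕ+ ℚ →ₐ[ℚ] Module.End ℚ A :=
  -- `MvPolynomial.aeval` needs a commutative target, so the evaluation happens in the subalgebra
  -- generated by the derivations.
  haveI : IsMulCommutative (Algebra.adjoin ℚ
      (Set.range fun i => (d i : Module.End ℚ A))) := by
    refine Algebra.isMulCommutative_adjoin ℚ ?_
    rintro _ ⟨i, rfl⟩ _ ⟨j, rfl⟩
    exact LinearMap.ext (hd i j)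
  (Subalgebra.val _).comp
    (MvPolynomial.aeval fun i => (⟨(d i : Module.End ℚ A), Algebra.subset_adjoin ⟨i, rfl⟩⟩ :
      Algebra.adjoin ℚ (Set.range fun i => (d i : Module.End ℚ A))))

variable (hd : ∀ i j a, d i (d j a) = d j (d i a))

theorem diffPoly_X (i : ℕ+) (a : A) : diffPoly d hd (MvPolynomial.X i) a = d i a := by
  simp [diffPoly]

theorem diffPoly_deriv (P : MvPolynomial ℕ+ ℚ) (i : ℕ+) (a : A) :
    diffPoly d hd P (d i a) = d i (diffPoly d hd P a) := by
  rw [← diffPoly_X d hd, ← diffPoly_X d hd, ← Module.End.mul_apply, ← Module.End.mul_apply,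
    ← map_mul, ← map_mul, mul_comm]

/-- The derivation `∂_n`, with the convention `∂_0 = 0`. -/
def derivOrZero (n : ℕ) : Derivation ℚ A A :=
  if h : 0 < n then d (n.toPNat h) else 0

@[simp]
theorem derivOrZero_zero : derivOrZero d 0 = 0 := by simp [derivOrZero]

theorem diffPoly_varOrZero (n : ℕ) (a : A) :
    diffPoly d hd (varOrZero n) a = derivOrZero d n a := by
  unfold varOrZero derivOrZero
  split_ifs
  · exact diffPoly_X d hd _ a
  · simp

/-- `F` solves `κ dF/dκ = c (∑_i κ^i ∂_i) F`, as `exp (c ∑_i κ^i ∂_i / i) a` does. -/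
def IsFlow (c : ℚ) (F : A⟦X⟧) : Prop :=
  ∀ n : ℕ, (n : ℚ) • coeff n F = c • ∑ p ∈ antidiagonal n, derivOrZero d p.1 (coeff p.2 F)

variable {d}

/-- Since `∂_0 = 0`, the equation in degree `n + 1` involves only lower coefficients on the right,
and `n + 1` is invertible. This uniqueness replaces all computation with exponentials below. -/
theorem IsFlow.ext {c : ℚ} {F G : A⟦X⟧} (hF : IsFlow d c F) (hG : IsFlow d c G)
    (h : coeff 0 F = coeff 0 G) : F = G := by
  ext n
  induction n using Nat.strong_induction_on with
  | _ n ih =>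
    cases n with
    | zero => exact h
    | succ n =>
      have h1 : ((n + 1 : ℕ) : ℚ) • coeff (n + 1) F = ((n + 1 : ℕ) : ℚ) • coeff (n + 1) G := by
        rw [hF, hG, Finset.Nat.antidiagonal_succ, Finset.sum_cons, Finset.sum_cons]
        simp only [derivOrZero_zero, Derivation.coe_zero, Pi.zero_apply, Finset.sum_map]
        congr 2
        refine Finset.sum_congr rfl fun p hp => ?_
        have := HasAntidiagonal.mem_antidiagonal.1 hp
        congr 1
        exact ih _ (by simp; omega)
      have h2 : ((n + 1 : ℕ) : ℚ) ≠ 0 := by positivity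
      have h3 := congrArg (((n + 1 : ℕ) : ℚ)⁻¹ • ·) h1
      simpa only [smul_smul, inv_mul_cancel₀ h2, one_smul] using h3

/-- Both `κ d/dκ` and `∑ κ^i ∂_i` are derivations of the power series ring. Hence the formal shift
is multiplicative. -/
theorem IsFlow.mul {c : ℚ} {F G : A⟦X⟧} (hF : IsFlow d c F) (hG : IsFlow d c G) :
    IsFlow d c (F * G) := by
  intro n
  have h1 : (n : ℚ) • coeff n (F * G) =
      ∑ p ∈ antidiagonal n, (((p.1 : ℚ) • coeff p.1 F) * coeff p.2 G +
        coeff p.1 F * ((p.2 : ℚ) • coeff p.2 G)) := by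
    rw [coeff_mul, Finset.smul_sum]
    refine Finset.sum_congr rfl fun p hp => ?_
    rw [← HasAntidiagonal.mem_antidiagonal.1 hp, smul_mul_assoc, mul_smul_comm, ← add_smul,
      Nat.cast_add]
  have h2 : ∑ p ∈ antidiagonal n, derivOrZero d p.1 (coeff p.2 (F * G)) =
      ∑ p ∈ antidiagonal n, ((∑ q ∈ antidiagonal p.1, derivOrZero d q.1 (coeff q.2 F)) *
        coeff p.2 G) +
      ∑ p ∈ antidiagonal n, coeff p.1 F *
        ∑ q ∈ antidiagonal p.2, derivOrZero d q.1 (coeff q.2 G) := by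
    simp only [coeff_mul, map_sum, Derivation.leibniz, smul_eq_mul, Finset.sum_add_distrib,
      Finset.sum_mul, Finset.mul_sum]
    rw [add_comm]
    congr 1
    · rw [sum_antidiagonal_assoc
        (fun i j k => derivOrZero d i (coeff j F) * coeff k G)]
      refine Finset.sum_congr rfl fun p _ => Finset.sum_congr rfl fun q _ => mul_comm _ _
    · rw [sum_antidiagonal_left_comm
        (fun i j k => coeff i F * derivOrZero d j (coeff k G))]
  rw [h1, h2]
  simp only [hF _, hG _]
  rw [smul_add, Finset.smul_sum, Finset.smul_sum, ← Finset.sum_add_distrib]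
  simp only [smul_mul_assoc, mul_smul_comm]

theorem IsFlow.one (c : ℚ) : IsFlow d c (1 : A⟦X⟧) := by
  intro n
  have h (m : ℕ) (D : Derivation ℚ A A) : D (coeff m (1 : A⟦X⟧)) = 0 := by
    rw [coeff_one]; split_ifs <;> simp
  simp only [h, Finset.sum_const_zero, smul_zero]
  cases n <;> simp [coeff_one]

variable (d)

/-- `exp (c ∑_i κ^i ∂_i / i) a`, the formal Taylor expansion of `a (x + c [κ])`. -/
def flowFun (c : ℚ) (a : A) : A⟦X⟧ :=
  PowerSeries.mk fun n => diffPoly d hd (schurTilde c n) a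

theorem isFlow_flowFun (c : ℚ) (a : A) : IsFlow d c (flowFun d hd c a) := by
  intro n
  have h := congrArg (fun P => diffPoly d hd P a) (smul_schurTilde c n)
  simp only [map_smul, map_sum, LinearMap.smul_apply, LinearMap.sum_apply, map_mul,
    Module.End.mul_apply, diffPoly_varOrZero] at h
  simpa only [flowFun, coeff_mk] using h

@[simp]
theorem coeff_zero_flowFun (c : ℚ) (a : A) : coeff 0 (flowFun d hd c a) = a := by
  simp [flowFun, schurTilde_zero]

/-- The formal shift `a ↦ a (x + c [κ])` is a ring homomorphism. -/
def flow (c : ℚ) : A →+* A⟦X⟧ where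
  toFun := flowFun d hd c
  map_one' := (isFlow_flowFun d hd c 1).ext (IsFlow.one c) (by simp)
  map_mul' a b := (isFlow_flowFun d hd c _).ext
    ((isFlow_flowFun d hd c a).mul (isFlow_flowFun d hd c b)) (by simp [coeff_mul])
  map_zero' := by ext; simp [flowFun]
  map_add' a b := by ext; simp [flowFun]

theorem coeff_flow (c : ℚ) (a : A) (n : ℕ) :
    coeff n (flow d hd c a) = diffPoly d hd (schurTilde c n) a := by
  simp [flow, flowFun]

theorem isFlow_flow (c : ℚ) (a : A) : IsFlow d c (flow d hd c a) :=
  isFlow_flowFun d hd c a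

@[simp]
theorem coeff_zero_flow (c : ℚ) (a : A) : coeff 0 (flow d hd c a) = a :=
  coeff_zero_flowFun d hd c a

theorem coeff_flow_derivOrZero (c : ℚ) (m n : ℕ) (a : A) :
    coeff n (flow d hd c (derivOrZero d m a)) = derivOrZero d m (coeff n (flow d hd c a)) := by
  unfold derivOrZero
  split_ifs
  · rw [coeff_flow, coeff_flow, diffPoly_deriv]
  · simp

@[simp]
theorem constantCoeff_flow (c : ℚ) (a : A) : constantCoeff (flow d hd c a) = a := by
  rw [← coeff_zero_eq_constantCoeff_apply, coeff_zero_flow]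

/-- A ring homomorphism that respects the derivations up to a common sign respects the shifts up to
that sign. -/
theorem flow_map {B : Type*} [CommRing B] [Algebra ℚ B] (e : ℕ+ → Derivation ℚ B B)
    (he : ∀ i j a, e i (e j a) = e j (e i a)) (φ : A →ₐ[ℚ] B) (ε : ℚ)
    (hφ : ∀ i a, e i (φ a) = ε • φ (d i a)) (c : ℚ) (a : A) :
    flow e he c (φ a) = PowerSeries.map (φ : A →+* B) (flow d hd (c * ε) a) := by
  refine (isFlow_flow e he c _).ext ?_ (by simp [coeff_map])
  intro n
  have hφ' (m : ℕ) (b : A) : derivOrZero e m (φ b) = ε • φ (derivOrZero d m b) := by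
    unfold derivOrZero
    split_ifs
    · exact hφ _ _
    · simp
  have h := congrArg φ (isFlow_flow d hd (c * ε) a n)
  simp only [map_smul, map_sum, mul_smul] at h
  simp only [coeff_map, RingHom.coe_coe, h, hφ', Finset.smul_sum]

/-- The extension of the formal shift `flow c` to power series in the shift parameter `κ`. -/
def shiftFun (c : ℚ) (F : A⟦X⟧) : A⟦X⟧ :=
  PowerSeries.mk fun n => ∑ p ∈ antidiagonal n, coeff p.1 (flow d hd c (coeff p.2 F))

theorem shiftFun_add (c : ℚ) (F G : A⟦X⟧) :
    shiftFun d hd c (F + G) = shiftFun d hd c F + shiftFun d hd c G := by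
  ext n; simp [shiftFun, Finset.sum_add_distrib]

theorem shiftFun_C (c : ℚ) (a : A) : shiftFun d hd c (C a) = flow d hd c a := by
  ext n
  rw [shiftFun, coeff_mk, Finset.sum_eq_single (n, 0)]
  · simp
  · rintro ⟨i, j⟩ h1 h2
    have : j ≠ 0 := by
      rintro rfl
      simp_all
    simp [coeff_C, this]
  · simp

theorem shiftFun_X_mul (c : ℚ) (F : A⟦X⟧) :
    shiftFun d hd c (X * F) = X * shiftFun d hd c F := by
  ext n
  cases n with
  | zero => simp [shiftFun]
  | succ n =>
    rw [coeff_succ_X_mul, shiftFun, shiftFun, coeff_mk, coeff_mk, Finset.Nat.antidiagonal_succ',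
      Finset.sum_cons, Finset.sum_map]
    simp [coeff_succ_X_mul]

theorem shiftFun_mul (c : ℚ) (F G : A⟦X⟧) :
    shiftFun d hd c (F * G) = shiftFun d hd c F * shiftFun d hd c G := by
  have split (F : A⟦X⟧) : ∃ a F', F = C a + X * F' :=
    ⟨coeff 0 F, PowerSeries.mk fun n => coeff (n + 1) F, by
      conv_lhs => rw [eq_X_mul_shift_add_const F]
      simp [add_comm]⟩
  ext n
  induction n generalizing F G with
  | zero => simp [shiftFun, coeff_mul]
  | succ n ih =>
    -- Splitting off constant terms reduces the claim to multiplicativity of `flow` and to products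
    -- taken one degree lower.
    obtain ⟨a, F, rfl⟩ := split F
    obtain ⟨b, G, rfl⟩ := split G
    have e1 : (C a + X * F) * (C b + X * G) =
        C (a * b) + X * (F * (C b + X * G) + C a * G) := by rw [map_mul]; ring
    have e2 : shiftFun d hd c (C a + X * F) * shiftFun d hd c (C b + X * G) =
        flow d hd c (a * b) + X * (shiftFun d hd c F * shiftFun d hd c (C b + X * G) +
          shiftFun d hd c (C a) * shiftFun d hd c G) := by
      simp only [shiftFun_add, shiftFun_C, shiftFun_X_mul, map_mul]; ring
    rw [e1, e2, shiftFun_add, shiftFun_C, shiftFun_X_mul, map_add, map_add, coeff_succ_X_mul,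
      coeff_succ_X_mul, shiftFun_add, map_add, map_add, ih, ih]

/-- The extension of the formal shift `flow c` to power series in the shift parameter `κ`, as a
ring homomorphism. -/
def shift (c : ℚ) : A⟦X⟧ →+* A⟦X⟧ where
  toFun := shiftFun d hd c
  map_one' := by
    have := shiftFun_C d hd c 1
    rwa [map_one, map_one] at this
  map_mul' := shiftFun_mul d hd c
  map_zero' := by
    have := shiftFun_C d hd c 0
    rwa [map_zero, map_zero] at this
  map_add' := shiftFun_add d hd c

theorem shift_X (c : ℚ) : shift d hd c X = X := by
  have := shiftFun_X_mul d hd c (C 1)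
  rw [shiftFun_C, map_one, map_one, mul_one] at this
  exact this

/-- The group law `exp(cL) exp(c'L) = exp((c + c')L)`. In the double sum for the left side, the
degree splits as `n = p.1 + p.2`; the first part yields the factor `c`, the second `c'`, because
`flow` commutes with the derivations. -/
theorem shift_flow (c c' : ℚ) (a : A) :
    shift d hd c (flow d hd c' a) = flow d hd (c + c') a := by
  refine IsFlow.ext ?_ (isFlow_flow d hd (c + c') a) ?_
  swap
  · change coeff 0 (shiftFun d hd c _) = _
    simp [shiftFun]
  intro n
  set F := flow d hd c' a with hF
  have hc (m : ℕ) : coeff m (shift d hd c F) =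
      ∑ p ∈ antidiagonal m, coeff p.1 (flow d hd c (coeff p.2 F)) := by
    change coeff m (shiftFun d hd c F) = _
    rw [shiftFun, coeff_mk]
  have h1 (m k : ℕ) : (m : ℚ) • coeff m (flow d hd c (coeff k F)) =
      c • ∑ q ∈ antidiagonal m, derivOrZero d q.1 (coeff q.2 (flow d hd c (coeff k F))) :=
    isFlow_flow d hd c _ m
  have h2 (m k : ℕ) : (m : ℚ) • coeff k (flow d hd c (coeff m F)) =
      c' • ∑ q ∈ antidiagonal m, derivOrZero d q.1 (coeff k (flow d hd c (coeff q.2 F))) := by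
    have hlin (r : ℚ) (b : A) :
        coeff k (flow d hd c (r • b)) = r • coeff k (flow d hd c b) := by
      simp only [coeff_flow, map_smul]
    rw [← hlin, hF, isFlow_flow d hd c' a m, ← hF, hlin, map_sum, map_sum]
    simp only [coeff_flow_derivOrZero]
  simp only [hc, map_sum]
  rw [add_smul]
  nth_rw 1 [← sum_antidiagonal_assoc
    (fun i j k => derivOrZero d i (coeff j (flow d hd c (coeff k F))))]
  rw [sum_antidiagonal_left_comm
    (fun i j k => derivOrZero d i (coeff j (flow d hd c (coeff k F))))]
  rw [Finset.smul_sum, Finset.smul_sum, Finset.smul_sum, ← Finset.sum_add_distrib]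
  refine Finset.sum_congr rfl fun p hp => ?_
  rw [← h1, ← h2, ← add_smul, ← HasAntidiagonal.mem_antidiagonal.1 hp, Nat.cast_add]

/-- The Toda and modified KP equations for `τ_n (x ± [κ] / 2)`, in generating function form. -/
structure IsFormalTau (τ : ℤ → A) : Prop where
  toda : ∀ n, flow d hd (1 / 2) (d 1 (τ n)) * flow d hd (-1 / 2) (τ n) -
    flow d hd (1 / 2) (τ n) * flow d hd (-1 / 2) (d 1 (τ n)) =
      X * (flow d hd (1 / 2) (τ (n + 1)) * flow d hd (-1 / 2) (τ (n - 1)))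
  modifiedKP : ∀ n, X * (flow d hd (1 / 2) (d 1 (τ (n + 1))) * flow d hd (-1 / 2) (τ n) -
    flow d hd (1 / 2) (τ (n + 1)) * flow d hd (-1 / 2) (d 1 (τ n))) =
      flow d hd (1 / 2) (τ (n + 1)) * flow d hd (-1 / 2) (τ n) -
        flow d hd (-1 / 2) (τ (n + 1)) * flow d hd (1 / 2) (τ n)

theorem flow_zero (a : A) : flow d hd 0 a = C a := by
  refine (isFlow_flow d hd 0 a).ext ?_ (by simp)
  intro n
  cases n <;> simp [coeff_C]

theorem shift_half_flow_half (a : A) :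
    shift d hd (1 / 2) (flow d hd (1 / 2) a) = flow d hd 1 a := by
  rw [shift_flow]; norm_num

theorem shift_half_flow_neg_half (a : A) :
    shift d hd (1 / 2) (flow d hd (-1 / 2) a) = C a := by
  rw [shift_flow, ← flow_zero d hd a]; norm_num

theorem shift_neg_half_flow_half (a : A) :
    shift d hd (-1 / 2) (flow d hd (1 / 2) a) = C a := by
  rw [shift_flow, ← flow_zero d hd a]; norm_num

theorem shift_neg_half_flow_neg_half (a : A) :
    shift d hd (-1 / 2) (flow d hd (-1 / 2) a) = flow d hd (-1) a := by
  rw [shift_flow]; norm_num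

/-- Shifting by `[κ]/2` moves the arguments `x ± [κ]/2` to `x + [κ]` and `x`. -/
theorem IsFormalTau.hankelDet_mul_eq {τ : ℤ → A} (hτ : IsFormalTau d hd τ) (k : ℤ)
    {q : A} (hq : q * τ k = τ (k + 1)) {m n : ℕ} (hu : ∀ i ≤ m, IsUnit (τ (k + (i : ℕ))))
    (hmn : m ≤ n) (h : n = m ∨ τ (k + (m + 1 : ℕ)) = 0 ∧ τ (k + (n + 1 : ℕ)) = 0) :
    hankelDet (flow d hd 1 q) (n + 1) * τ k = τ (k + (n + 1 : ℕ)) := by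
  have key := hankelDet_mul_eq_of_ringHom (Φ := flow d hd 1)
    (constantCoeff_flow d hd 1)
    (D := d 1) (t := fun j => τ (k + (j : ℕ))) ?_ ?_ (q := q) (by simpa using hq) hu hmn h
  · simpa using key
  · intro j
    have := congrArg (shift d hd (1 / 2)) (hτ.toda (k + (j + 1 : ℕ)))
    simp only [map_sub, map_mul, shift_half_flow_half, shift_half_flow_neg_half, shift_X] at this
    rw [this]
    congr 4 <;> push_cast <;> ring
  · intro j
    have := congrArg (shift d hd (1 / 2)) (hτ.modifiedKP (k + (j : ℕ)))
    simp only [map_sub, map_mul, shift_half_flow_half, shift_half_flow_neg_half, shift_X] at this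
    rw [Nat.cast_add, Nat.cast_one, ← add_assoc]
    exact this

/-- Shifting by `-[κ]/2` gives the arguments `x` and `x - [κ]`. Under the index reversal `j ↦ k - j`
the equations keep their form only after `κ ↦ -κ`, whence the sign `(-1)^i` in `b_i`. -/
theorem IsFormalTau.hankelDet_mul_eq' {τ : ℤ → A} (hτ : IsFormalTau d hd τ) (k : ℤ)
    {q : A} (hq : q * τ k = τ (k - 1)) {m n : ℕ} (hu : ∀ i ≤ m, IsUnit (τ (k - (i : ℕ))))
    (hmn : m ≤ n) (h : n = m ∨ τ (k - (m + 1 : ℕ)) = 0 ∧ τ (k - (n + 1 : ℕ)) = 0) :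
    hankelDet (rescale (-1) (flow d hd (-1) q)) (n + 1) * τ k = τ (k - (n + 1 : ℕ)) := by
  have rC (a : A) : rescale (-1 : A) (C a) = C a := by
    ext n; cases n <;> simp [coeff_C]
  have key := hankelDet_mul_eq_of_ringHom (Φ := (rescale (-1 : A)).comp (flow d hd (-1)))
    (fun a => by simp [← coeff_zero_eq_constantCoeff_apply, coeff_rescale])
    (D := d 1) (t := fun j => τ (k - (j : ℕ))) ?_ ?_ (q := q) (by simpa using hq) hu hmn h
  · simpa using key
  · intro j
    have := congrArg (fun F => rescale (-1 : A) (shift d hd (-1 / 2) F))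
      (hτ.toda (k - (j + 1 : ℕ)))
    simp only [map_sub, map_mul, shift_neg_half_flow_half, shift_neg_half_flow_neg_half, shift_X,
      rescale_neg_one_X, rC] at this
    rw [show k - (j + 1 : ℕ) + 1 = k - (j : ℕ) by push_cast; ring,
      show k - (j + 1 : ℕ) - 1 = k - (j + 2 : ℕ) by push_cast; ring] at this
    simp only [RingHom.comp_apply]
    linear_combination -this
  · intro j
    have := congrArg (fun F => rescale (-1 : A) (shift d hd (-1 / 2) F))
      (hτ.modifiedKP (k - (j + 1 : ℕ)))
    simp only [map_sub, map_mul, shift_neg_half_flow_half, shift_neg_half_flow_neg_half, shift_X,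
      rescale_neg_one_X, rC] at this
    rw [show k - (j + 1 : ℕ) + 1 = k - (j : ℕ) by push_cast; ring] at this
    simp only [RingHom.comp_apply]
    linear_combination this

end Differential

/-! ### Partial derivatives on finite-dimensional slices -/

section Calculus

open Topology Function

variable {𝕜 𝕂 : Type*} [RCLike 𝕜] [RCLike 𝕂] [NormedAlgebra 𝕜 𝕂]
  {U W : Set (ℕ+ → 𝕜)} {f g : (ℕ+ → 𝕜) → 𝕂}

theorem updateFinset_update {α : Type*} (x : ℕ+ → α) {s : Finset ℕ+} (y : s → α) {i : ℕ+}
    (hi : i ∈ s) (t : α) :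
    updateFinset x s (update y ⟨i, hi⟩ t) = update (updateFinset x s y) i t := by
  ext j
  by_cases hj : j = i
  · subst hj; simp [updateFinset, hi]
  · by_cases hs : j ∈ s <;> simp [updateFinset, hs, hj, Subtype.ext_iff]

theorem updateFinset_self {α : Type*} (x : ℕ+ → α) (s : Finset ℕ+) :
    updateFinset x s (fun j => x j) = x := by
  ext j
  by_cases hs : j ∈ s <;> simp [updateFinset, hs]

theorem FinOpen.eventually_update (hW : FinOpen W) {x : ℕ+ → 𝕜} (hx : x ∈ W) (i : ℕ+) :
    ∀ᶠ t in 𝓝 (x i), update x i t ∈ W := by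
  have h1 : Continuous fun t : 𝕜 => (fun _ => t : ↥({i} : Finset ℕ+) → 𝕜) :=
    continuous_pi fun _ => continuous_id
  have h2 := (hW x {i}).preimage h1
  have h3 : x i ∈ (fun t : 𝕜 => (fun _ => t : ↥({i} : Finset ℕ+) → 𝕜)) ⁻¹'
      {y | updateFinset x {i} y ∈ W} := by
    simpa [updateFinset_singleton] using hx
  filter_upwards [h2.mem_nhds h3] with t ht
  simpa [updateFinset_singleton] using ht

theorem partialD_congr (hW : FinOpen W) (h : ∀ x ∈ W, f x = g x) {x : ℕ+ → 𝕜} (hx : x ∈ W)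
    (i : ℕ+) : partialD i f x = partialD i g x := by
  refine Filter.EventuallyEq.deriv_eq ?_
  filter_upwards [hW.eventually_update hx i] with t ht
  exact h _ ht

theorem SmoothOn.congr (hf : SmoothOn W f) (h : ∀ x ∈ W, g x = f x) : SmoothOn W g :=
  fun x s => (hf x s).congr fun _ hy => h _ hy

theorem SmoothOn.mono (hf : SmoothOn U f) (h : W ⊆ U) : SmoothOn W f :=
  fun x s => (hf x s).mono fun _ hy => h hy

theorem SmoothOn.const (c : 𝕂) : SmoothOn W (fun _ => c) :=
  fun _ _ => contDiffOn_const

theorem SmoothOn.add (hf : SmoothOn W f) (hg : SmoothOn W g) :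
    SmoothOn W (fun x => f x + g x) :=
  fun x s => (hf x s).add (hg x s)

theorem SmoothOn.mul (hf : SmoothOn W f) (hg : SmoothOn W g) :
    SmoothOn W (fun x => f x * g x) :=
  fun x s => (hf x s).mul (hg x s)

theorem SmoothOn.inv (hf : SmoothOn W f) (h : ∀ x ∈ W, f x ≠ 0) :
    SmoothOn W (fun x => (f x)⁻¹) :=
  fun x s => (hf x s).inv fun _ hy => h _ hy

theorem FinOpen.inter_ne_zero (hW : FinOpen W) (hf : SmoothOn W f) :
    FinOpen {x | x ∈ W ∧ f x ≠ 0} :=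
  fun x s => (hf x s).continuousOn.isOpen_inter_preimage (hW x s) isOpen_ne

theorem SmoothOn.contDiffAt (hW : FinOpen W) (hf : SmoothOn W f) (x : ℕ+ → 𝕜) (s : Finset ℕ+)
    {y : s → 𝕜} (hy : updateFinset x s y ∈ W) :
    ContDiffAt 𝕜 ∞ (fun y : s → 𝕜 => f (updateFinset x s y)) y :=
  (hf x s).contDiffAt ((hW x s).mem_nhds hy)

/-- The chain rule along a coordinate line of a slice; it lets results on `fderiv` apply to
`partialD`. -/
theorem SmoothOn.hasDerivAt_updateFinset (hW : FinOpen W) (hf : SmoothOn W f) (x : ℕ+ → 𝕜)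
    (s : Finset ℕ+) {y : s → 𝕜} (hy : updateFinset x s y ∈ W) {i : ℕ+} (hi : i ∈ s) :
    HasDerivAt (fun t : 𝕜 => f (update (updateFinset x s y) i t))
      (fderiv 𝕜 (fun y : s → 𝕜 => f (updateFinset x s y)) y (Pi.single ⟨i, hi⟩ 1))
      (updateFinset x s y i) := by
  have h1 := ((hf.contDiffAt hW x s hy).differentiableAt (by simp)).hasFDerivAt
  have h2 : updateFinset x s y i = y ⟨i, hi⟩ := by simp [updateFinset, hi]
  have h3 : update y ⟨i, hi⟩ (y ⟨i, hi⟩) = y := update_eq_self _ _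
  rw [← h3] at h1
  have h4 := h1.comp_hasDerivAt (y ⟨i, hi⟩) (hasDerivAt_update y ⟨i, hi⟩ (y ⟨i, hi⟩))
  rw [h3] at h4
  rw [h2]
  convert! h4 using 1
  ext t
  simp only [comp_apply, updateFinset_update]

theorem SmoothOn.partialD_updateFinset (hW : FinOpen W) (hf : SmoothOn W f) (x : ℕ+ → 𝕜)
    (s : Finset ℕ+) {y : s → 𝕜} (hy : updateFinset x s y ∈ W) {i : ℕ+} (hi : i ∈ s) :
    partialD i f (updateFinset x s y) =
      fderiv 𝕜 (fun y : s → 𝕜 => f (updateFinset x s y)) y (Pi.single ⟨i, hi⟩ 1) :=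
  (hf.hasDerivAt_updateFinset hW x s hy hi).deriv

theorem SmoothOn.differentiableAt_update (hW : FinOpen W) (hf : SmoothOn W f) {x : ℕ+ → 𝕜}
    (hx : x ∈ W) (i : ℕ+) :
    DifferentiableAt 𝕜 (fun t : 𝕜 => f (update x i t)) (x i) := by
  have := (hf.hasDerivAt_updateFinset hW x {i} (y := fun j => x j)
    (by rwa [updateFinset_self]) (Finset.mem_singleton_self i)).differentiableAt
  rwa [updateFinset_self] at this

theorem partialD_add (hW : FinOpen W) (hf : SmoothOn W f) (hg : SmoothOn W g) {x : ℕ+ → 𝕜}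
    (hx : x ∈ W) (i : ℕ+) :
    partialD i (fun x => f x + g x) x = partialD i f x + partialD i g x :=
  deriv_fun_add (hf.differentiableAt_update hW hx i) (hg.differentiableAt_update hW hx i)

theorem partialD_mul (hW : FinOpen W) (hf : SmoothOn W f) (hg : SmoothOn W g) {x : ℕ+ → 𝕜}
    (hx : x ∈ W) (i : ℕ+) :
    partialD i (fun x => f x * g x) x = partialD i f x * g x + f x * partialD i g x := by
  have := deriv_fun_mul (hf.differentiableAt_update hW hx i) (hg.differentiableAt_update hW hx i)
  simp only [update_eq_self] at this
  exact this

/-- It suffices to check smoothness in sets of variables that contain a given one. -/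
theorem smoothOn_of_mem (i : ℕ+)
    (h : ∀ (x : ℕ+ → 𝕜) (s : Finset ℕ+), i ∈ s →
      ContDiffOn 𝕜 ∞ (fun y : s → 𝕜 => f (updateFinset x s y)) {y | updateFinset x s y ∈ W}) :
    SmoothOn W f := by
  intro x s
  let ι : (s → 𝕜) → (↥(insert i s : Finset ℕ+) → 𝕜) := fun y j => updateFinset x s y j
  have hι : ContDiff 𝕜 ∞ ι := by
    refine contDiff_pi.2 fun j => ?_
    by_cases hj : (j : ℕ+) ∈ s
    · simp only [ι, updateFinset, hj, dif_pos]
      exact contDiff_apply 𝕜 𝕜 _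
    · simp only [ι, updateFinset, hj, dif_neg, not_false_eq_true]
      exact contDiff_const
  have e (y : s → 𝕜) : updateFinset x (insert i s) (ι y) = updateFinset x s y := by
    ext j
    by_cases hj : j ∈ insert i s
    · simp [ι, updateFinset, hj]
    · have : j ∉ s := fun h => hj (Finset.mem_insert_of_mem h)
      simp [updateFinset, hj, this]
  have := (h x (insert i s) (Finset.mem_insert_self i s)).comp hι.contDiffOn
    (s := {y | updateFinset x s y ∈ W}) (fun y hy => by simpa only [Set.mem_ofPred_eq, e] using hy)
  simpa only [comp_def, e] using this

theorem SmoothOn.partialD (hW : FinOpen W) (hf : SmoothOn W f) (i : ℕ+) :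
    SmoothOn W (partialD i f) := by
  refine smoothOn_of_mem i fun x s hi => ?_
  have h1 := (hf x s).fderiv_of_isOpen (m := ∞) (hW x s) (by simp)
  have h2 : ContDiffOn 𝕜 ∞ (fun y => fderiv 𝕜 (fun y : s → 𝕜 => f (updateFinset x s y)) y
      (Pi.single ⟨i, hi⟩ 1)) {y | updateFinset x s y ∈ W} := h1.clm_apply contDiffOn_const
  exact h2.congr fun y hy => hf.partialD_updateFinset hW x s hy hi

theorem partialD_comm (hW : FinOpen W) (hf : SmoothOn W f) {x : ℕ+ → 𝕜} (hx : x ∈ W)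
    (i j : ℕ+) :
    TodaKP.partialD i (TodaKP.partialD j f) x = TodaKP.partialD j (TodaKP.partialD i f) x := by
  -- On the slice in these two variables the claim is the symmetry of the second derivative.
  let s : Finset ℕ+ := {i, j}
  let y : s → 𝕜 := fun a => x a
  have hi : i ∈ s := by simp [s]
  have hj : j ∈ s := by simp [s]
  have hxy : updateFinset x s y = x := updateFinset_self x s
  have hy : updateFinset x s y ∈ W := by rwa [hxy]
  let F := fun y : s → 𝕜 => f (updateFinset x s y)
  have hF : ContDiffAt 𝕜 ∞ F y := hf.contDiffAt hW x s hy
  have key (a b : ℕ+) (ha : a ∈ s) (hb : b ∈ s) :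
      TodaKP.partialD a (TodaKP.partialD b f) x =
        fderiv 𝕜 (fderiv 𝕜 F) y (Pi.single ⟨a, ha⟩ 1) (Pi.single ⟨b, hb⟩ 1) := by
    conv_lhs => rw [← hxy]
    rw [(hf.partialD hW b).partialD_updateFinset hW x s hy ha]
    have h1 : (fun y : s → 𝕜 => TodaKP.partialD b f (updateFinset x s y)) =ᶠ[𝓝 y]
        fun y => fderiv 𝕜 F y (Pi.single ⟨b, hb⟩ 1) := by
      filter_upwards [(hW x s).mem_nhds hy] with z hz
      exact hf.partialD_updateFinset hW x s hz hb
    rw [h1.fderiv_eq]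
    have h2 : DifferentiableAt 𝕜 (fderiv 𝕜 F) y :=
      (hF.fderiv_right (m := 1) (by norm_cast)).differentiableAt one_ne_zero
    rw [fderiv_clm_apply h2 (differentiableAt_const _)]
    simp
  rw [key i j hi hj, key j i hj hi]
  exact hF.isSymmSndFDerivAt (by simp; norm_cast) _ _

theorem updateFinset_affine (x z : ℕ+ → 𝕜) (c : 𝕜) (s : Finset ℕ+) (y : s → 𝕜) :
    x + c • updateFinset z s y = updateFinset (x + c • z) s (fun j => x j + c * y j) := by
  ext j
  by_cases hj : j ∈ s <;> simp [updateFinset, hj]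

theorem FinOpen.preimage_affine (hW : FinOpen W) (x : ℕ+ → 𝕜) (c : 𝕜) :
    FinOpen {y | x + c • y ∈ W} := by
  intro z s
  simp only [Set.mem_ofPred_eq, updateFinset_affine]
  exact (hW (x + c • z) s).preimage (f := fun (y : s → 𝕜) (j : s) => x j + c * y j) (by fun_prop)

theorem SmoothOn.comp_affine (hf : SmoothOn W f) (x : ℕ+ → 𝕜) (c : 𝕜) :
    SmoothOn {y | x + c • y ∈ W} (fun y => f (x + c • y)) := by
  intro z s
  simp only [Set.mem_ofPred_eq, updateFinset_affine]
  exact (hf (x + c • z) s).comp (t := {y | updateFinset (x + c • z) s y ∈ W})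
    (g := fun y : s → 𝕜 => f (updateFinset (x + c • z) s y))
    (f := fun (y : s → 𝕜) (j : s) => x j + c * y j)
    (ContDiff.contDiffOn (by fun_prop)) fun y hy => hy

theorem FinOpen.inter (hU : FinOpen U) (hW : FinOpen W) : FinOpen (U ∩ W) :=
  fun x s => (hU x s).inter (hW x s)

theorem partialD_comp_affine (x : ℕ+ → 𝕜) (c : 𝕜) (y : ℕ+ → 𝕜) (i : ℕ+) :
    TodaKP.partialD i (fun y => f (x + c • y)) y = c • TodaKP.partialD i f (x + c • y) := by
  have h (t : 𝕜) : x + c • update y i t = update (x + c • y) i (x i + c * t) := by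
    ext j
    by_cases hj : j = i
    · subst hj; simp
    · simp [hj]
  simp only [TodaKP.partialD, h]
  have h1 := deriv_comp_mul_left (𝕜 := 𝕜) c (fun u => f (update (x + c • y) i (x i + u))) (y i)
  rw [deriv_comp_const_add (f := fun u => f (update (x + c • y) i u))] at h1
  exact h1

end Calculus

/-! ### The algebra of smooth functions, and Hirota's operators as formal shifts -/

section SmoothAlgebra

open Topology Function

/-- The extension of a function on `W` by zero. -/
def zeroExt {𝕜 𝕂 : Type*} [Zero 𝕂] {W : Set (ℕ+ → 𝕜)} (a : W → 𝕂) : (ℕ+ → 𝕜) → 𝕂 :=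
  Function.extend Subtype.val a 0

theorem zeroExt_apply {𝕜 𝕂 : Type*} [Zero 𝕂] {W : Set (ℕ+ → 𝕜)} (a : W → 𝕂) {x : ℕ+ → 𝕜}
    (hx : x ∈ W) : zeroExt a x = a ⟨x, hx⟩ :=
  Subtype.val_injective.extend_apply a 0 ⟨x, hx⟩

variable {𝕜 𝕂 : Type*} [RCLike 𝕜] [RCLike 𝕂] [NormedAlgebra 𝕜 𝕂]
  {U W : Set (ℕ+ → 𝕜)} {f g : (ℕ+ → 𝕜) → 𝕂}

variable (𝕂 W) in
/-- The algebra of smooth functions on `W`. -/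
def smoothAlg : Subalgebra ℚ (W → 𝕂) where
  carrier := {a | SmoothOn W (zeroExt a)}
  mul_mem' {a b} ha hb := by
    refine (SmoothOn.mul ha hb).congr fun x hx => ?_
    simp [zeroExt_apply _ hx]
  add_mem' {a b} ha hb := by
    refine (SmoothOn.add ha hb).congr fun x hx => ?_
    simp [zeroExt_apply _ hx]
  algebraMap_mem' q := by
    refine (SmoothOn.const (q : 𝕂)).congr fun x hx => ?_
    rw [zeroExt_apply _ hx]
    simp

/-- The restriction to `W` of a function that is smooth on `W`. -/
def SmoothOn.restrict (hf : SmoothOn W f) : smoothAlg 𝕂 W :=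
  ⟨fun x => f x, hf.congr fun _ hx => zeroExt_apply _ hx⟩

variable (𝕂) in
/-- The derivation `∂ / ∂x_i` of the algebra of smooth functions on `W`. -/
def smoothDeriv (hW : FinOpen W) (i : ℕ+) : Derivation ℚ (smoothAlg 𝕂 W) (smoothAlg 𝕂 W) :=
  Derivation.mk'
    (AddMonoidHom.toRatLinearMap
      { toFun := fun a => (SmoothOn.partialD hW a.2 i).restrict
        map_zero' := by
          ext ⟨x, hx⟩
          refine (partialD_congr (g := fun _ => 0) hW (fun y hy => ?_) hx i).trans ?_
          · rw [zeroExt_apply _ hy]; rfl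
          · exact deriv_const _ _
        map_add' := fun a b => by
          ext ⟨x, hx⟩
          refine (partialD_congr hW (fun y hy => ?_) hx i).trans (partialD_add hW a.2 b.2 hx i)
          simp [zeroExt_apply _ hy] })
    (fun a b => by
      ext ⟨x, hx⟩
      refine (partialD_congr hW (fun y hy => ?_) hx i).trans
        ((partialD_mul hW a.2 b.2 hx i).trans ?_)
      · simp [zeroExt_apply _ hy]
      · rw [zeroExt_apply _ hx, zeroExt_apply _ hx, add_comm, mul_comm (partialD _ _ _)]
        rfl)

/-- The evaluation of smooth functions at a point. -/
def evalAt {x : ℕ+ → 𝕜} (hx : x ∈ W) : smoothAlg 𝕂 W →ₐ[ℚ] 𝕂 :=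
  (Pi.evalAlgHom ℚ (fun _ : W => 𝕂) ⟨x, hx⟩).comp (Subalgebra.val _)

theorem smoothAlg_ext {a b : smoothAlg 𝕂 W} (h : ∀ x, ∀ hx : x ∈ W, evalAt hx a = evalAt hx b) :
    a = b :=
  Subtype.ext (funext fun x => h x x.2)

theorem evalAt_restrict (hf : SmoothOn W f) {x : ℕ+ → 𝕜} (hx : x ∈ W) :
    evalAt hx hf.restrict = f x := rfl

theorem zeroExt_eq_evalAt (a : smoothAlg 𝕂 W) {x : ℕ+ → 𝕜} (hx : x ∈ W) :
    zeroExt (a : W → 𝕂) x = evalAt hx a := zeroExt_apply _ hx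

theorem evalAt_smoothDeriv (hW : FinOpen W) (i : ℕ+) (a : smoothAlg 𝕂 W) {x : ℕ+ → 𝕜}
    (hx : x ∈ W) :
    evalAt hx (smoothDeriv 𝕂 hW i a) = partialD i (zeroExt (a : W → 𝕂)) x := rfl

variable (𝕂) in
theorem smoothDeriv_comm (hW : FinOpen W) (i j : ℕ+) (a : smoothAlg 𝕂 W) :
    smoothDeriv 𝕂 hW i (smoothDeriv 𝕂 hW j a) = smoothDeriv 𝕂 hW j (smoothDeriv 𝕂 hW i a) := by
  refine smoothAlg_ext fun x hx => ?_
  have h (k : ℕ+) : ∀ y ∈ W, zeroExt (smoothDeriv 𝕂 hW k a : W → 𝕂) y =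
      partialD k (zeroExt (a : W → 𝕂)) y := fun y hy => zeroExt_apply _ hy
  rw [evalAt_smoothDeriv, evalAt_smoothDeriv, partialD_congr hW (h i) hx,
    partialD_congr hW (h j) hx]
  exact partialD_comm hW a.2 hx i j

variable (𝕂) in
/-- `P (∂_1, ∂_2, …)` on smooth functions. -/
abbrev smoothPoly (hW : FinOpen W) :
    MvPolynomial ℕ+ ℚ →ₐ[ℚ] Module.End ℚ (smoothAlg 𝕂 W) :=
  diffPoly (smoothDeriv 𝕂 hW) (smoothDeriv_comm 𝕂 hW)

theorem foldr_partialD (hW : FinOpen W) (hf : SmoothOn W f) (l : List ℕ+) :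
    ∀ {x : ℕ+ → 𝕜} (hx : x ∈ W), l.foldr partialD f x =
      evalAt hx (smoothPoly 𝕂 hW (l.map MvPolynomial.X).prod hf.restrict) := by
  induction l with
  | nil => intro x hx; simp [evalAt_restrict]
  | cons i l ih =>
    intro x hx
    rw [List.foldr_cons, List.map_cons, List.prod_cons, map_mul, Module.End.mul_apply,
      diffPoly_X, evalAt_smoothDeriv]
    refine partialD_congr hW (fun y hy => ?_) hx i
    rw [ih hy, zeroExt_eq_evalAt _ hy]

/-- The sorted order of differentiation disappears because a monomial is a commutative product. -/
theorem iterPartialD_eq (hW : FinOpen W) (hf : SmoothOn W f) (m : ℕ+ →₀ ℕ) {x : ℕ+ → 𝕜}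
    (hx : x ∈ W) :
    iterPartialD m f x =
      evalAt hx (smoothPoly 𝕂 hW (MvPolynomial.monomial m 1) hf.restrict) := by
  rw [iterPartialD, foldr_partialD hW hf _ hx]
  have h : ((m.toMultiset.sort (· ≤ ·)).map (MvPolynomial.X (R := ℚ))).prod =
      MvPolynomial.monomial m 1 := by
    rw [← Multiset.prod_coe, ← Multiset.map_coe, Multiset.sort_eq, MvPolynomial.monomial_eq,
      map_one, one_mul, Finsupp.toMultiset_map, Finsupp.prod_toMultiset,
      Finsupp.prod_mapDomain_index (by simp) (by simp [pow_add])]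
  rw [h]

theorem diffOp_eq (hW : FinOpen W) (hf : SmoothOn W f) (P : MvPolynomial ℕ+ ℚ) {x : ℕ+ → 𝕜}
    (hx : x ∈ W) :
    diffOp P f x = evalAt hx (smoothPoly 𝕂 hW P hf.restrict) := by
  conv_rhs => rw [P.as_sum]
  rw [diffOp, map_sum, LinearMap.sum_apply, map_sum]
  refine Finset.sum_congr rfl fun m _ => ?_
  rw [iterPartialD_eq hW hf m hx]
  have : MvPolynomial.monomial m (P.coeff m) =
      P.coeff m • MvPolynomial.monomial m (1 : ℚ) := by
    rw [MvPolynomial.smul_monomial, smul_eq_mul, mul_one]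
  rw [this, map_smul, LinearMap.smul_apply, map_smul, Rat.smul_def]

/-- The homomorphism `a ↦ (y ↦ a (x + c y))`. -/
def affinePullback (x : ℕ+ → 𝕜) (c : ℚ) {V : Set (ℕ+ → 𝕜)}
    (hV : ∀ y ∈ V, x + (c : 𝕜) • y ∈ W) : smoothAlg 𝕂 W →ₐ[ℚ] smoothAlg 𝕂 V where
  toFun a := ⟨fun y => (a : W → 𝕂) ⟨x + (c : 𝕜) • (y : ℕ+ → 𝕜), hV y y.2⟩,
    ((SmoothOn.comp_affine a.2 x (c : 𝕜)).mono hV).congr fun y hy => by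
      rw [zeroExt_apply _ hy, zeroExt_apply _ (hV y hy)]⟩
  map_one' := rfl
  map_mul' _ _ := rfl
  map_zero' := rfl
  map_add' _ _ := rfl
  commutes' _ := rfl

theorem smoothDeriv_affinePullback (hW : FinOpen W) (x : ℕ+ → 𝕜) (c : ℚ) {V : Set (ℕ+ → 𝕜)}
    (hVo : FinOpen V) (hV : ∀ y ∈ V, x + (c : 𝕜) • y ∈ W) (i : ℕ+) (a : smoothAlg 𝕂 W) :
    smoothDeriv 𝕂 hVo i (affinePullback x c hV a) =
      c • affinePullback x c hV (smoothDeriv 𝕂 hW i a) := by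
  refine smoothAlg_ext fun y hy => ?_
  rw [evalAt_smoothDeriv, partialD_congr hVo
    (g := fun y => zeroExt (a : W → 𝕂) (x + (c : 𝕜) • y)) (fun z hz => ?_) hy]
  · rw [partialD_comp_affine, Rat.cast_smul_eq_qsmul]
    rfl
  · rw [zeroExt_apply _ hz, zeroExt_apply _ (hV z hz)]
    rfl

variable (𝕂) in
/-- The formal shift by `c [κ]` of a smooth function. -/
abbrev smoothFlow (hW : FinOpen W) (c : ℚ) : smoothAlg 𝕂 W →+* PowerSeries (smoothAlg 𝕂 W) :=
  flow (smoothDeriv 𝕂 hW) (smoothDeriv_comm 𝕂 hW) c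

theorem smoothFlow_affinePullback (hW : FinOpen W) (x : ℕ+ → 𝕜) (c : ℚ) {V : Set (ℕ+ → 𝕜)}
    (hVo : FinOpen V) (hV : ∀ y ∈ V, x + (c : 𝕜) • y ∈ W) (q : ℚ) (a : smoothAlg 𝕂 W) :
    smoothFlow 𝕂 hVo q (affinePullback x c hV a) =
      PowerSeries.map (affinePullback x c hV).toRingHom (smoothFlow 𝕂 hW (q * c) a) :=
  flow_map (smoothDeriv 𝕂 hW) (smoothDeriv_comm 𝕂 hW) (smoothDeriv 𝕂 hVo)
    (smoothDeriv_comm 𝕂 hVo) (affinePullback x c hV) c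
    (smoothDeriv_affinePullback hW x c hVo hV) q a

theorem evalAt_coeff {x : ℕ+ → 𝕜} (hx : x ∈ W) (F : PowerSeries (smoothAlg 𝕂 W)) (n : ℕ) :
    evalAt hx (PowerSeries.coeff n F) =
      PowerSeries.coeff n (PowerSeries.map (evalAt (𝕂 := 𝕂) hx).toRingHom F) :=
  (PowerSeries.coeff_map _ _ _).symm

theorem evalAt_affinePullback (x : ℕ+ → 𝕜) (c : ℚ) {V : Set (ℕ+ → 𝕜)}
    (hV : ∀ y ∈ V, x + (c : 𝕜) • y ∈ W) {y z : ℕ+ → 𝕜} (hy : y ∈ V) (hz : z ∈ W)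
    (h : x + (c : 𝕜) • y = z) (a : smoothAlg 𝕂 W) :
    evalAt hy (affinePullback x c hV a) = evalAt hz a := by
  subst h; rfl

theorem map_evalAt_map_affinePullback (x : ℕ+ → 𝕜) (c : ℚ) {V : Set (ℕ+ → 𝕜)}
    (hV : ∀ y ∈ V, x + (c : 𝕜) • y ∈ W) {y z : ℕ+ → 𝕜} (hy : y ∈ V) (hz : z ∈ W)
    (h : x + (c : 𝕜) • y = z) (F : PowerSeries (smoothAlg 𝕂 W)) :
    PowerSeries.map (evalAt (𝕂 := 𝕂) hy).toRingHom
      (PowerSeries.map (affinePullback x c hV).toRingHom F) =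
        PowerSeries.map (evalAt (𝕂 := 𝕂) hz).toRingHom F := by
  refine PowerSeries.ext fun m => ?_
  rw [PowerSeries.coeff_map, PowerSeries.coeff_map, PowerSeries.coeff_map]
  exact evalAt_affinePullback x c hV hy hz h _

/-- The domain of `y ↦ f (x + y) g (x - y)`. -/
def hirotaDomain (W : Set (ℕ+ → 𝕜)) (x : ℕ+ → 𝕜) : Set (ℕ+ → 𝕜) :=
  {y | x + ((1 : ℚ) : 𝕜) • y ∈ W} ∩ {y | x + ((-1 : ℚ) : 𝕜) • y ∈ W}

theorem add_mem_of_mem_hirotaDomain {x : ℕ+ → 𝕜} :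
    ∀ y ∈ hirotaDomain W x, x + ((1 : ℚ) : 𝕜) • y ∈ W := fun _ hy => hy.1

theorem sub_mem_of_mem_hirotaDomain {x : ℕ+ → 𝕜} :
    ∀ y ∈ hirotaDomain W x, x + ((-1 : ℚ) : 𝕜) • y ∈ W := fun _ hy => hy.2

theorem finOpen_hirotaDomain (hW : FinOpen W) (x : ℕ+ → 𝕜) : FinOpen (hirotaDomain W x) :=
  (hW.preimage_affine x _).inter (hW.preimage_affine x _)

theorem zero_mem_hirotaDomain {x : ℕ+ → 𝕜} (hx : x ∈ W) : 0 ∈ hirotaDomain W x := by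
  simpa [hirotaDomain] using hx

/-- The function `y ↦ a (x + y) b (x - y)`. -/
def hirotaProd (x : ℕ+ → 𝕜) (a b : smoothAlg 𝕂 W) : smoothAlg 𝕂 (hirotaDomain W x) :=
  affinePullback x 1 add_mem_of_mem_hirotaDomain a *
    affinePullback x (-1) sub_mem_of_mem_hirotaDomain b

theorem smoothDeriv_hirotaProd (hW : FinOpen W) (x : ℕ+ → 𝕜) (i : ℕ+) (a b : smoothAlg 𝕂 W) :
    smoothDeriv 𝕂 (finOpen_hirotaDomain hW x) i (hirotaProd x a b) =
      hirotaProd x (smoothDeriv 𝕂 hW i a) b - hirotaProd x a (smoothDeriv 𝕂 hW i b) := by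
  rw [hirotaProd, Derivation.leibniz, smoothDeriv_affinePullback hW,
    smoothDeriv_affinePullback hW, hirotaProd, hirotaProd]
  simp only [smul_eq_mul, neg_smul, one_smul]
  ring

theorem hirota_eq (hW : FinOpen W) (hf : SmoothOn W f) (hg : SmoothOn W g)
    (P : MvPolynomial ℕ+ ℚ) {x : ℕ+ → 𝕜} (hx : x ∈ W) :
    hirota P f g x = evalAt (zero_mem_hirotaDomain hx)
      (smoothPoly 𝕂 (finOpen_hirotaDomain hW x) P
        (hirotaProd x hf.restrict hg.restrict)) := by
  have e (y : ℕ+ → 𝕜) : f (x + y) * g (x - y) =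
      f (x + ((1 : ℚ) : 𝕜) • y) * g (x + ((-1 : ℚ) : 𝕜) • y) := by
    simp [sub_eq_add_neg]
  have hs : SmoothOn (hirotaDomain W x) (fun y => f (x + y) * g (x - y)) := by
    simp only [e]
    exact ((hf.comp_affine x _).mono fun y hy => hy.1).mul
      ((hg.comp_affine x _).mono fun y hy => hy.2)
  rw [hirota, diffOp_eq (finOpen_hirotaDomain hW x) hs P (zero_mem_hirotaDomain hx)]
  congr 2
  exact smoothAlg_ext fun y hy => e y

/-- The shift in `y` is multiplicative, and the reflection in `b (x - y)` reverses its sign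
(`flow_map`), so `p_n(c D̃)` extracts the `κ^n` coefficient of `a(x + c[κ]) b(x - c[κ])`. -/
theorem smoothPoly_schurTilde_hirotaProd (hW : FinOpen W) (c : ℚ) (n : ℕ)
    (a b : smoothAlg 𝕂 W) {x : ℕ+ → 𝕜} (hx : x ∈ W) :
    evalAt (zero_mem_hirotaDomain hx)
      (smoothPoly 𝕂 (finOpen_hirotaDomain hW x) (schurTilde c n) (hirotaProd x a b)) =
        evalAt hx (PowerSeries.coeff n (smoothFlow 𝕂 hW c a * smoothFlow 𝕂 hW (-c) b)) := by
  rw [← coeff_flow, hirotaProd, RingHom.map_mul,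
    smoothFlow_affinePullback hW x 1 (finOpen_hirotaDomain hW x),
    smoothFlow_affinePullback hW x (-1) (finOpen_hirotaDomain hW x), mul_one, mul_neg_one,
    evalAt_coeff, evalAt_coeff, RingHom.map_mul, RingHom.map_mul,
    map_evalAt_map_affinePullback x 1 _ _ hx (by simp),
    map_evalAt_map_affinePullback x (-1) _ _ hx (by simp)]

theorem smoothPoly_X_mul_schurTilde_hirotaProd (hW : FinOpen W) (c : ℚ) (n : ℕ)
    (a b : smoothAlg 𝕂 W) {x : ℕ+ → 𝕜} (hx : x ∈ W) :
    evalAt (zero_mem_hirotaDomain hx)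
      (smoothPoly 𝕂 (finOpen_hirotaDomain hW x) (MvPolynomial.X 1 * schurTilde c n)
        (hirotaProd x a b)) =
        evalAt hx (PowerSeries.coeff n
          (smoothFlow 𝕂 hW c (smoothDeriv 𝕂 hW 1 a) * smoothFlow 𝕂 hW (-c) b -
            smoothFlow 𝕂 hW c a * smoothFlow 𝕂 hW (-c) (smoothDeriv 𝕂 hW 1 b))) := by
  rw [mul_comm, map_mul, Module.End.mul_apply, diffPoly_X, smoothDeriv_hirotaProd, map_sub,
    map_sub, map_sub, map_sub, smoothPoly_schurTilde_hirotaProd hW _ _ _ _ hx,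
    smoothPoly_schurTilde_hirotaProd hW _ _ _ _ hx]

/-- The Hirota equations with index `j` are the coefficients of `κ^{j+1}`; the constant coefficients
agree by commutativity alone. -/
theorem IsTau.isFormalTau {τ : ℤ → (ℕ+ → 𝕜) → 𝕂} (hτ : IsTau U τ) (hW : FinOpen W)
    (hWU : W ⊆ U) :
    IsFormalTau (smoothDeriv 𝕂 hW) (smoothDeriv_comm 𝕂 hW)
      (fun n => ((hτ.smooth n).mono hWU).restrict) where
  toda n := by
    refine PowerSeries.ext fun m => ?_
    cases m with
    | zero =>
      rw [PowerSeries.coeff_zero_X_mul]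
      simp [mul_comm]
    | succ m =>
      rw [PowerSeries.coeff_succ_X_mul]
      refine smoothAlg_ext fun x hx => ?_
      have h := hτ.toda n m x (hWU hx)
      rw [hirota_eq hW ((hτ.smooth n).mono hWU) ((hτ.smooth n).mono hWU) _ hx,
        hirota_eq hW ((hτ.smooth (n + 1)).mono hWU) ((hτ.smooth (n - 1)).mono hWU) _ hx,
        smoothPoly_X_mul_schurTilde_hirotaProd hW _ _ _ _ hx,
        smoothPoly_schurTilde_hirotaProd hW _ _ _ _ hx] at h
      rw [neg_div]
      exact h
  modifiedKP n := by
    refine PowerSeries.ext fun m => ?_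
    cases m with
    | zero =>
      rw [PowerSeries.coeff_zero_X_mul]
      simp [mul_comm]
    | succ m =>
      rw [PowerSeries.coeff_succ_X_mul]
      refine smoothAlg_ext fun x hx => ?_
      have h := hτ.modifiedKP n m x (hWU hx)
      rw [hirota_eq hW ((hτ.smooth (n + 1)).mono hWU) ((hτ.smooth n).mono hWU) _ hx, map_add,
        map_sub, LinearMap.add_apply, LinearMap.sub_apply, map_add, map_sub,
        smoothPoly_X_mul_schurTilde_hirotaProd hW _ _ _ _ hx,
        smoothPoly_schurTilde_hirotaProd hW _ _ _ _ hx,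
        smoothPoly_schurTilde_hirotaProd hW _ _ _ _ hx, neg_div, neg_neg] at h
      rw [neg_div, map_sub (PowerSeries.coeff (m + 1)), map_sub (evalAt hx),
        ← sub_eq_zero, ← h]
      ring

end SmoothAlgebra

/-! ### Determinants of functions and removal of the nonvanishing assumptions -/

section Determinants

variable {𝕜 𝕂 : Type*} [RCLike 𝕜] [RCLike 𝕂] [NormedAlgebra 𝕜 𝕂]
  {U W : Set (ℕ+ → 𝕜)} {τ : ℤ → (ℕ+ → 𝕜) → 𝕂}

theorem SmoothOn.div {f g : (ℕ+ → 𝕜) → 𝕂} (hf : SmoothOn W f) (hg : SmoothOn W g)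
    (h : ∀ x ∈ W, g x ≠ 0) : SmoothOn W (fun x => f x / g x) := by
  simp only [div_eq_mul_inv]
  exact hf.mul (hg.inv h)

theorem evalAt_hankelDet {x : ℕ+ → 𝕜} (hx : x ∈ W) (F : PowerSeries (smoothAlg 𝕂 W)) (n : ℕ) :
    evalAt hx (hankelDet F n) =
      (Matrix.of fun i j : Fin n =>
        evalAt hx (PowerSeries.coeff ((i : ℕ) + (j : ℕ)) F)).det := by
  rw [hankelDet, AlgHom.map_det]
  rfl

theorem det_entryA (hW : FinOpen W) (k : ℤ)
    (hq : SmoothOn W (fun x => τ (k + 1) x / τ k x)) (n : ℕ) {x : ℕ+ → 𝕜} (hx : x ∈ W) :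
    (Matrix.of fun i j : Fin n => entryA τ k ((i : ℕ) + (j : ℕ)) x).det =
      evalAt hx (hankelDet (smoothFlow 𝕂 hW 1 hq.restrict) n) := by
  rw [evalAt_hankelDet]
  congr 2
  ext i j
  rw [coeff_flow, entryA, diffOp_eq hW hq _ hx]

theorem det_entryB (hW : FinOpen W) (k : ℤ)
    (hq : SmoothOn W (fun x => τ (k - 1) x / τ k x)) (n : ℕ) {x : ℕ+ → 𝕜} (hx : x ∈ W) :
    (Matrix.of fun i j : Fin n => entryB τ k ((i : ℕ) + (j : ℕ)) x).det =
      evalAt hx (hankelDet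
        (PowerSeries.rescale (-1) (smoothFlow 𝕂 hW (-1) hq.restrict)) n) := by
  rw [evalAt_hankelDet]
  congr 2
  ext i j
  rw [PowerSeries.coeff_rescale, coeff_flow, entryB, diffOp_eq hW hq _ hx, map_mul, map_pow,
    map_neg, map_one]

theorem smoothOn_evalAt (a : smoothAlg 𝕂 W) {f : (ℕ+ → 𝕜) → 𝕂}
    (h : ∀ x, ∀ hx : x ∈ W, f x = evalAt hx a) : SmoothOn W f :=
  SmoothOn.congr a.2 fun x hx => (h x hx).trans (zeroExt_eq_evalAt a hx).symm

theorem isUnit_restrict {f : (ℕ+ → 𝕜) → 𝕂} (hf : SmoothOn W f) (h : ∀ x ∈ W, f x ≠ 0) :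
    IsUnit hf.restrict :=
  IsUnit.of_mul_eq_one (hf.inv h).restrict (smoothAlg_ext fun x hx => by
    rw [map_mul, evalAt_restrict, evalAt_restrict, map_one, mul_inv_cancel₀ (h x hx)])

theorem restrict_eq_zero {f : (ℕ+ → 𝕜) → 𝕂} (hf : SmoothOn W f) (h : ∀ x ∈ W, f x = 0) :
    hf.restrict = 0 :=
  smoothAlg_ext fun x hx => by rw [evalAt_restrict, map_zero, h x hx]

theorem IsTau.det_entryA_mul (hτ : IsTau U τ) (hW : FinOpen W) (hWU : W ⊆ U) (k : ℤ) {m n : ℕ}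
    (hu : ∀ i ≤ m, ∀ x ∈ W, τ (k + (i : ℕ)) x ≠ 0) (hmn : m ≤ n)
    (h : n = m ∨ ∀ x ∈ W, τ (k + (m + 1 : ℕ)) x = 0 ∧ τ (k + (n + 1 : ℕ)) x = 0)
    {x : ℕ+ → 𝕜} (hx : x ∈ W) :
    (Matrix.of fun i j : Fin (n + 1) => entryA τ k ((i : ℕ) + (j : ℕ)) x).det * τ k x =
      τ (k + (n + 1 : ℕ)) x := by
  have hs (l : ℤ) : SmoothOn W (τ l) := (hτ.smooth l).mono hWU
  have h0 : ∀ x ∈ W, τ k x ≠ 0 := by simpa using hu 0 (Nat.zero_le _)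
  have hq := (hs (k + 1)).div (hs k) h0
  have key := (hτ.isFormalTau hW hWU).hankelDet_mul_eq _ _ k (q := hq.restrict)
    (smoothAlg_ext fun y hy => by
      rw [map_mul, evalAt_restrict, evalAt_restrict, evalAt_restrict, div_mul_cancel₀ _ (h0 y hy)])
    (fun i hi => isUnit_restrict (hs _) (hu i hi)) hmn
    (h.imp_right fun h => ⟨restrict_eq_zero (hs _) fun y hy => (h y hy).1,
      restrict_eq_zero (hs _) fun y hy => (h y hy).2⟩)
  have := congrArg (evalAt hx) key
  rwa [map_mul, ← det_entryA] at this

theorem IsTau.det_entryB_mul (hτ : IsTau U τ) (hW : FinOpen W) (hWU : W ⊆ U) (k : ℤ) {m n : ℕ}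
    (hu : ∀ i ≤ m, ∀ x ∈ W, τ (k - (i : ℕ)) x ≠ 0) (hmn : m ≤ n)
    (h : n = m ∨ ∀ x ∈ W, τ (k - (m + 1 : ℕ)) x = 0 ∧ τ (k - (n + 1 : ℕ)) x = 0)
    {x : ℕ+ → 𝕜} (hx : x ∈ W) :
    (Matrix.of fun i j : Fin (n + 1) => entryB τ k ((i : ℕ) + (j : ℕ)) x).det * τ k x =
      τ (k - (n + 1 : ℕ)) x := by
  have hs (l : ℤ) : SmoothOn W (τ l) := (hτ.smooth l).mono hWU
  have h0 : ∀ x ∈ W, τ k x ≠ 0 := by simpa using hu 0 (Nat.zero_le _)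
  have hq := (hs (k - 1)).div (hs k) h0
  have key := (hτ.isFormalTau hW hWU).hankelDet_mul_eq' _ _ k (q := hq.restrict)
    (smoothAlg_ext fun y hy => by
      rw [map_mul, evalAt_restrict, evalAt_restrict, evalAt_restrict, div_mul_cancel₀ _ (h0 y hy)])
    (fun i hi => isUnit_restrict (hs _) (hu i hi)) hmn
    (h.imp_right fun h => ⟨restrict_eq_zero (hs _) fun y hy => (h y hy).1,
      restrict_eq_zero (hs _) fun y hy => (h y hy).2⟩)
  have := congrArg (evalAt hx) key
  rwa [map_mul, ← det_entryB] at this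

/-- An identity that holds on all open sets on which the `u_i` either do not vanish or vanish
identically from some index on holds everywhere. -/
theorem mul_eq_of_forall_finOpen (hW : FinOpen W) {u : ℕ → (ℕ+ → 𝕜) → 𝕂}
    {D : (ℕ+ → 𝕜) → 𝕂} (hu : ∀ i, SmoothOn W (u i)) (hD : SmoothOn W D)
    (h0 : ∀ x ∈ W, u 0 x ≠ 0) (n : ℕ)
    (hgap : ∀ V ⊆ W, FinOpen V → ∀ m < n, (∀ x ∈ V, u (m + 1) x = 0) →
      ∀ x ∈ V, u (n + 1) x = 0)
    (hloc : ∀ V ⊆ W, FinOpen V → ∀ m ≤ n, (∀ i ≤ m, ∀ x ∈ V, u i x ≠ 0) →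
      (n = m ∨ ∀ x ∈ V, u (m + 1) x = 0 ∧ u (n + 1) x = 0) →
        ∀ x ∈ V, D x * u 0 x = u (n + 1) x)
    {x : ℕ+ → 𝕜} (hx : x ∈ W) : D x * u 0 x = u (n + 1) x := by
  by_contra hne
  let G : (ℕ+ → 𝕜) → 𝕂 := fun x => D x * u 0 x + (-1) * u (n + 1) x
  have hGs : SmoothOn W G := (hD.mul (hu 0)).add ((SmoothOn.const (-1)).mul (hu (n + 1)))
  have hG0 (y : ℕ+ → 𝕜) : G y = 0 ↔ D y * u 0 y = u (n + 1) y := by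
    change D y * u 0 y + (-1) * u (n + 1) y = 0 ↔ _
    rw [neg_one_mul, ← sub_eq_add_neg, sub_eq_zero]
  -- Starting from the open set where the identity fails, one more `u i` is made nonvanishing at
  -- each stage. If some `u (m + 1)` vanishes identically on `V`, the terminating case of `hloc`
  -- already contradicts `G ≠ 0`.
  have claim : ∀ m ≤ n, ∃ V ⊆ W, FinOpen V ∧ V.Nonempty ∧ (∀ y ∈ V, G y ≠ 0) ∧
      ∀ i ≤ m, ∀ y ∈ V, u i y ≠ 0 := by
    intro m
    induction m with
    | zero =>
      intro _
      refine ⟨{y | y ∈ W ∧ G y ≠ 0}, fun y hy => hy.1, hW.inter_ne_zero hGs,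
        ⟨x, hx, fun h => hne ((hG0 x).1 h)⟩, fun y hy => hy.2, fun i hi y hy => ?_⟩
      rw [Nat.le_zero.1 hi]
      exact h0 y hy.1
    | succ m ih =>
      intro hm
      obtain ⟨V, hVW, hV, hne, hVG, hVu⟩ := ih (by omega)
      by_cases hz : ∀ y ∈ V, u (m + 1) y = 0
      · obtain ⟨y, hy⟩ := hne
        refine absurd ((hG0 y).2 ?_) (hVG y hy)
        exact hloc V hVW hV m (by omega) hVu
          (Or.inr fun z hz' => ⟨hz z hz', hgap V hVW hV m (by omega) hz z hz'⟩) y hy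
      · push Not at hz
        refine ⟨{y | y ∈ V ∧ u (m + 1) y ≠ 0}, fun y hy => hVW hy.1,
          hV.inter_ne_zero ((hu (m + 1)).mono hVW), hz, fun y hy => hVG y hy.1,
          fun i hi y hy => ?_⟩
        rcases Nat.le_succ_iff.1 hi with h | h
        · exact hVu i h y hy.1
        · rw [h]; exact hy.2
  obtain ⟨V, hVW, hV, ⟨y, hy⟩, hVG, hVu⟩ := claim n le_rfl
  exact hVG y hy ((hG0 y).2 (hloc V hVW hV n le_rfl hVu (Or.inl rfl) y hy))

theorem IsTau.det_entryA_mul_of_noGaps (hU : FinOpen U) (hτ : IsTau U τ) (hgap : NoGaps U τ)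
    (k : ℤ) (n : ℕ) {x : ℕ+ → 𝕜} (hx : x ∈ U) (hk : τ k x ≠ 0) :
    (Matrix.of fun i j : Fin (n + 1) => entryA τ k ((i : ℕ) + (j : ℕ)) x).det * τ k x =
      τ (k + (n + 1 : ℕ)) x := by
  have hW := hU.inter_ne_zero (hτ.smooth k)
  have hWU : {y | y ∈ U ∧ τ k y ≠ 0} ⊆ U := fun y hy => hy.1
  have hs (l : ℤ) : SmoothOn {y | y ∈ U ∧ τ k y ≠ 0} (τ l) := (hτ.smooth l).mono hWU
  have hq := (hs (k + 1)).div (hs k) fun y hy => hy.2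
  have key := mul_eq_of_forall_finOpen hW (u := fun j => τ (k + (j : ℕ)))
    -- The determinant is smooth since it is given by an element of `smoothAlg`.
    (fun i => hs _) (smoothOn_evalAt _ fun y hy => det_entryA hW k hq (n + 1) hy)
    (by simp) n ?_ ?_ (x := x) ⟨hx, hk⟩
  · simpa using key
  · intro V hV hVo m hm hz y hy
    have h := hgap V (hV.trans hWU) hVo k (k + (m + 1 : ℕ)) (k + (n + 1 : ℕ))
      (by push_cast; omega) (by push_cast; omega) hz y hy
    exact (mul_eq_zero.1 h).resolve_left (hV hy).2
  · intro V hV hVo m hm hu h y hy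
    simpa using hτ.det_entryA_mul hVo (hV.trans hWU) k hu hm h hy

theorem IsTau.det_entryB_mul_of_noGaps (hU : FinOpen U) (hτ : IsTau U τ) (hgap : NoGaps U τ)
    (k : ℤ) (n : ℕ) {x : ℕ+ → 𝕜} (hx : x ∈ U) (hk : τ k x ≠ 0) :
    (Matrix.of fun i j : Fin (n + 1) => entryB τ k ((i : ℕ) + (j : ℕ)) x).det * τ k x =
      τ (k - (n + 1 : ℕ)) x := by
  have hW := hU.inter_ne_zero (hτ.smooth k)
  have hWU : {y | y ∈ U ∧ τ k y ≠ 0} ⊆ U := fun y hy => hy.1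
  have hs (l : ℤ) : SmoothOn {y | y ∈ U ∧ τ k y ≠ 0} (τ l) := (hτ.smooth l).mono hWU
  have hq := (hs (k - 1)).div (hs k) fun y hy => hy.2
  have key := mul_eq_of_forall_finOpen hW (u := fun j => τ (k - (j : ℕ)))
    (fun i => hs _) (smoothOn_evalAt _ fun y hy => det_entryB hW k hq (n + 1) hy)
    (by simp) n ?_ ?_ (x := x) ⟨hx, hk⟩
  · simpa using key
  · intro V hV hVo m hm hz y hy
    have h := hgap V (hV.trans hWU) hVo (k - (n + 1 : ℕ)) (k - (m + 1 : ℕ)) k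
      (by push_cast; omega) (by push_cast; omega) hz y hy
    exact (mul_eq_zero.1 h).resolve_right (hV hy).2
  · intro V hV hVo m hm hu h y hy
    simpa using hτ.det_entryB_mul hVo (hV.trans hWU) k hu hm h hy

end Determinants

end TodaKP

end

theorem proposition2 {𝕜 𝕂 : Type*} [RCLike 𝕜] [RCLike 𝕂] [NormedAlgebra 𝕜 𝕂]
    (U : Set (ℕ+ → 𝕜)) (hU : TodaKP.FinOpen U)
    (τ : ℤ → (ℕ+ → 𝕜) → 𝕂) (hτ : TodaKP.IsTau U τ) (hgap : TodaKP.NoGaps U τ)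
    (k n : ℤ) (x : ℕ+ → 𝕜) (hx : x ∈ U) (hk : τ k x ≠ 0) :
    τ (k + n) x / τ k x =
      if 0 < n then
        (Matrix.of fun i j : Fin n.natAbs => TodaKP.entryA τ k ((i : ℕ) + (j : ℕ)) x).det
      else if n = 0 then 1
      else
        (Matrix.of fun i j : Fin n.natAbs => TodaKP.entryB τ k ((i : ℕ) + (j : ℕ)) x).det := by
  split_ifs with hpos hzero
  · obtain ⟨N, hN⟩ : ∃ N : ℕ, n.natAbs = N + 1 := ⟨n.natAbs - 1, by omega⟩
    have hn : n = (N + 1 : ℕ) := by omega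
    rw [hN, div_eq_iff hk, hτ.det_entryA_mul_of_noGaps hU hgap k N hx hk, hn]
  · rw [hzero, add_zero, div_self hk]
  · obtain ⟨N, hN⟩ : ∃ N : ℕ, n.natAbs = N + 1 := ⟨n.natAbs - 1, by omega⟩
    have hn : k + n = k - (N + 1 : ℕ) := by omega
    rw [hN, div_eq_iff hk, hτ.det_entryB_mul_of_noGaps hU hgap k N hx hk, hn]
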